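/- **Setting.** Let $D\subset\mathbb C^n$ be open and invariant under each conjugation $z\mapsto\overline z^h=(z_1,\dots,\overline z_h,\dots,z_n)$, $h=1,\dots,n$, let $\mathbb S=\{J\in\mathbb H: J^2=-1\}$, and let $$\Omega_D=\{(\alpha_1+J_1\beta_1,\dots,\alpha_n+J_n\beta_n) : (\alpha_1+i\beta_1,\dots,\alpha_n+i\beta_n)\in D,\ J_1,\dots,J_n\in\mathbb S\}\subset\mathbb H^n .$$ A *stem function* on $D$ is a family $F=(F_K)_{K\subset\{1,\dots,n\}}$, written $F=\sum_K e_KF_K$, of functions $F_K:D\to\mathbb H$ with $F_K(\overline z^h)=(-1)^{|K\cap\{h\}|}F_K(z)$ for all $K$ and $h$. It induces $f:\Omega_D\to\mathbb H$, $$f(\alpha_1+J_1\beta_1,\dots,\alpha_n+J_n\beta_n)=\sum_{K} J_{k_1}\cdots J_{k_p}F_K(z),\qquad K=\{k_1<\dots<k_p\},\ z=(\alpha_1+i\beta_1,\dots,\alpha_n+i\beta_n).$$ Functions so induced are called *slice functions*, and slice functions *of class $\mathcal S^1$* if $F$ can be chosen in $\mathcal C^1(D)$. A slice function is *slice regular*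 if it is induced by a stem function $F\in\mathcal C^1(D)$ with $\frac12\left(\frac{\partial F}{\partial\alpha_h}+\mathcal J_h\frac{\partial F}{\partial\beta_h}\right)=0$ for every $h$, where $\mathcal J_h(q\,e_K)=(-1)^{|K\cap\{h\}|}q\,e_{K\triangle\{h\}}$. A slice function $f$ on $\Omega_D$ is *slice regular in $x_m$* if for every $y\in\Omega_D$ the restriction $x\mapsto f(y_1,\dots,y_{m-1},x,y_{m+1},\dots,y_n)$ is a slice regular function of one variable on $\{x\in\mathbb H:(y_1,\dots,y_{m-1},x,y_{m+1},\dots,y_n)\in\Omega_D\}$. Writing $x_m=\alpha_m+i\beta_m+j\gamma_m+k\delta_m$ in real coordinates, put $$\overline\partial_{x_m}=\tfrac12\left(\tfrac{\partial}{\partial\alpha_m}+i\tfrac{\partial}{\partial\beta_m}+j\tfrac{\partial}{\partial\gamma_m}+k\tfrac{\partial}{\partial\delta_m}\right),\qquad \Delta_m=\tfrac{\partial^2}{\partial\alpha_m^2}+\tfrac{\partial^2}{\partial\beta_m^2}+\tfrac{\partial^2}{\partial\gamma_m^2}+\tfrac{\partial^2}{\partial\delta_m^2}.$$ A function on $\Omega_D$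 is *$x_m$-axially monogenic* if it is a slice function of class $\mathcal C^1(\Omega_D)$ annihilated by $\overline\partial_{x_m}$. **Corollary (Fueter's theorem in several variables).** Let $m\in\{1,\dots,n\}$ and let $f$ be a slice function on $\Omega_D$ that is slice regular in $x_m$. Then $f$ is of class $\mathcal C^2$ in $x_m$ (for fixed other variables), and $\Delta_mf$ is a slice function on $\Omega_D$ which is of class $\mathcal C^1$ in $x_m$ and satisfies $\overline\partial_{x_m}\Delta_mf=0$ on $\Omega_D$. If moreover $f$ is of class $\mathcal S^1$, then $\Delta_mf\in\mathcal C^1(\Omega_D)$, so that $\Delta_mf$ is $x_m$-axially monogenic. -/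

import Mathlib

open scoped Quaternion

namespace SliceFueter

/-- Conjugation of the `h`-th coordinate of a point of `ℂⁿ`. -/
def conjAt {n : ℕ} (h : Fin n) (z : Fin n → ℂ) : Fin n → ℂ :=
  Function.update z h (starRingEnd ℂ (z h))

/-- `D ⊆ ℂⁿ` is invariant under conjugation of each single coordinate. -/
def IsConjInvariant {n : ℕ} (D : Set (Fin n → ℂ)) : Prop :=
  ∀ z, ∀ h, z ∈ D ↔ conjAt h z ∈ D

/-- `J = (J₁, …, Jₙ)` is a tuple of quaternionic imaginary units. -/
def IsUnits {n : ℕ} (J : Fin n → ℍ[ℝ]) : Prop :=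
  ∀ h, J h * J h = -1

/-- The point `(α₁ + J₁β₁, …, αₙ + Jₙβₙ)` of `ℍⁿ`, where `z = (α₁ + iβ₁, …, αₙ + iβₙ)`. -/
noncomputable def point {n : ℕ} (z : Fin n → ℂ) (J : Fin n → ℍ[ℝ]) : Fin n → ℍ[ℝ] :=
  fun h => ((z h).re : ℍ[ℝ]) + J h * ((z h).im : ℍ[ℝ])

/-- The circularization `Ω_D ⊆ ℍⁿ` of `D ⊆ ℂⁿ`. -/
def circ {n : ℕ} (D : Set (Fin n → ℂ)) : Set (Fin n → ℍ[ℝ]) :=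
  {x | ∃ z ∈ D, ∃ J, IsUnits J ∧ x = point z J}

/-- The product `J_K = J_{k₁} ⋯ J_{kₚ}`, `k₁ < ⋯ < kₚ` the elements of `K`. -/
noncomputable def orderedProd {n : ℕ} (K : Finset (Fin n)) (J : Fin n → ℍ[ℝ]) : ℍ[ℝ] :=
  ((K.sort (· ≤ ·)).map J).prod

/-- `F = ∑_K e_K F_K : D → ℍ ⊗ ℝ^{2ⁿ}` is a stem function; elements of `ℍ ⊗ ℝ^{2ⁿ}` are families
of quaternions indexed by the subsets `K` of the set of variables, so `F_K (z)` is `F z K`. -/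
def IsStem {n : ℕ} (D : Set (Fin n → ℂ)) (F : (Fin n → ℂ) → Finset (Fin n) → ℍ[ℝ]) : Prop :=
  IsConjInvariant D ∧ ∀ z ∈ D, ∀ h K, F (conjAt h z) K = (-1) ^ (K ∩ {h}).card * F z K

/-- `f` is the function on `Ω_D` induced by `F`, i.e. `f (x) = ∑_K [J_K, F_K (z)]` for every
representation `x = (α₁ + J₁β₁, …, αₙ + Jₙβₙ)` with `z = (α₁ + iβ₁, …, αₙ + iβₙ) ∈ D`. -/
def Induces {n : ℕ} (D : Set (Fin n → ℂ)) (F : (Fin n → ℂ) → Finset (Fin n) → ℍ[ℝ])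
    (f : (Fin n → ℍ[ℝ]) → ℍ[ℝ]) : Prop :=
  ∀ z ∈ D, ∀ J, IsUnits J →
    f (point z J) = ∑ K : Finset (Fin n), orderedProd K J * F z K

/-- `f` is a slice function on `Ω_D`. -/
def IsSlice {n : ℕ} (D : Set (Fin n → ℂ)) (f : (Fin n → ℍ[ℝ]) → ℍ[ℝ]) : Prop :=
  ∃ F, IsStem D F ∧ Induces D F f

/-- `f` is a slice function on `Ω_D` induced by a stem function of class `C¹` on `D`. -/
def IsSliceC1 {n : ℕ} (D : Set (Fin n → ℂ)) (f : (Fin n → ℍ[ℝ]) → ℍ[ℝ]) : Prop :=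
  ∃ F, IsStem D F ∧ ContDiffOn ℝ 1 F D ∧ Induces D F f

/-- The complex structure `𝒥_h (q ⊗ e_K) = (-1)^{|K ∩ {h}|} q ⊗ e_{K Δ {h}}` on `ℍ ⊗ ℝ^{2ⁿ}`:
the `K`-component of `𝒥_h A` comes from the component of `A` with index `K Δ {h}`. -/
noncomputable def cplxStr {n : ℕ} (h : Fin n) (A : Finset (Fin n) → ℍ[ℝ]) : Finset (Fin n) → ℍ[ℝ] :=
  fun K => (-1) ^ (symmDiff K {h} ∩ {h}).card * A (symmDiff K {h})

/-- `∂̄_h F = ½ (∂F/∂α_h + 𝒥_h ∂F/∂β_h)`. -/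
noncomputable def stemDbar {n : ℕ} (h : Fin n) (F : (Fin n → ℂ) → Finset (Fin n) → ℍ[ℝ])
    (z : Fin n → ℂ) : Finset (Fin n) → ℍ[ℝ] :=
  (1 / 2 : ℝ) • (lineDeriv ℝ F z (Pi.single h 1)
    + cplxStr h (lineDeriv ℝ F z (Pi.single h Complex.I)))

/-- `f` is slice regular on `Ω_D`: it is induced by a holomorphic stem function, that is a `C¹`
one with `∂̄_h F = 0` for every `h`. -/
def IsSliceRegular {n : ℕ} (D : Set (Fin n → ℂ)) (f : (Fin n → ℍ[ℝ]) → ℍ[ℝ]) : Prop :=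
  ∃ F, IsStem D F ∧ ContDiffOn ℝ 1 F D ∧ (∀ h, ∀ z ∈ D, stemDbar h F z = 0) ∧ Induces D F f

/-- `Ω_{D,h}(y) = {x ∈ ℍ | (y₁, …, y_{h-1}, x, y_{h+1}, …, yₙ) ∈ Ω_D}`. -/
def section1 {n : ℕ} (D : Set (Fin n → ℂ)) (h : Fin n) (y : Fin n → ℍ[ℝ]) : Set ℍ[ℝ] :=
  {x | Function.update y h x ∈ circ D}

/-- The subset of `ℂ = ℂ¹` whose circularization is `Ω_{D,h}(y)` (see `circ_fiber`). -/
def fiber {n : ℕ} (D : Set (Fin n → ℂ)) (h : Fin n) (y : Fin n → ℍ[ℝ]) : Set (Fin 1 → ℂ) :=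
  {w | ∀ J, IsUnits J → point w J 0 ∈ section1 D h y}

theorem circ_fiber {n : ℕ} (D : Set (Fin n → ℂ)) (h : Fin n)
    (y : Fin n → ℍ[ℝ]) : circ (fiber D h y) = {x | x 0 ∈ section1 D h y} := by
  ext x
  constructor
  · rintro ⟨w, hw, J, hJ, rfl⟩
    exact hw J hJ
  · rintro ⟨z, hz, J, hJ, hzJ⟩
    have hx : x 0 = ((z h).re : ℍ[ℝ]) + J h * ((z h).im : ℍ[ℝ]) := by
      have := congrFun hzJ h
      simpa [point] using this
    refine ⟨fun _ => z h, ?_, fun _ => J h, fun _ => hJ h, ?_⟩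
    · intro I hI
      refine ⟨z, hz, Function.update J h (I 0), ?_, ?_⟩
      · intro k
        by_cases hk : k = h
        · subst hk; simpa using hI 0
        · simpa [hk] using hJ k
      · funext k
        by_cases hk : k = h
        · subst hk; simp [point]
        · have := congrFun hzJ k
          simpa [point, hk] using this
    · funext k
      rw [Subsingleton.elim k 0, hx]
      rfl

/-- `f` is a slice function on `Ω_D` which is slice regular with respect to `x_h`: all its
restrictions `x ↦ f (y₁, …, y_{h-1}, x, y_{h+1}, …, yₙ)` are one-variable slice regular
functions. -/
def IsSliceRegularIn {n : ℕ} (D : Set (Fin n → ℂ)) (h : Fin n)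
    (f : (Fin n → ℍ[ℝ]) → ℍ[ℝ]) : Prop :=
  IsSlice D f ∧ ∀ y ∈ circ D,
    IsSliceRegular (fiber D h y) (fun x : Fin 1 → ℍ[ℝ] => f (Function.update y h (x 0)))

/-- The real partial derivative of `f` in the direction `e ∈ ℍ` of the variable `x_h`. -/
noncomputable def pderiv {n : ℕ} (h : Fin n) (e : ℍ[ℝ]) (f : (Fin n → ℍ[ℝ]) → ℍ[ℝ])
    (x : Fin n → ℍ[ℝ]) : ℍ[ℝ] :=
  lineDeriv ℝ f x (Pi.single h e)

/-- The quaternionic unit `i`. -/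
def qi : ℍ[ℝ] := ⟨0, 1, 0, 0⟩

/-- The quaternionic unit `j`. -/
def qj : ℍ[ℝ] := ⟨0, 0, 1, 0⟩

/-- The quaternionic unit `k`. -/
def qk : ℍ[ℝ] := ⟨0, 0, 0, 1⟩

/-- The Cauchy–Riemann–Fueter operator
`∂̄_{x_h} = ½ (∂/∂α_h + i ∂/∂β_h + j ∂/∂γ_h + k ∂/∂δ_h)`. -/
noncomputable def dbar {n : ℕ} (h : Fin n) (f : (Fin n → ℍ[ℝ]) → ℍ[ℝ]) (x : Fin n → ℍ[ℝ]) :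
    ℍ[ℝ] :=
  (1 / 2 : ℝ) • (pderiv h 1 f x + qi * pderiv h qi f x + qj * pderiv h qj f x
    + qk * pderiv h qk f x)

/-- The Laplacian `Δ_h = ∂²/∂α_h² + ∂²/∂β_h² + ∂²/∂γ_h² + ∂²/∂δ_h²`. -/
noncomputable def lapl {n : ℕ} (h : Fin n) (f : (Fin n → ℍ[ℝ]) → ℍ[ℝ]) (x : Fin n → ℍ[ℝ]) :
    ℍ[ℝ] :=
  pderiv h 1 (pderiv h 1 f) x + pderiv h qi (pderiv h qi f) x
    + pderiv h qj (pderiv h qj f) x + pderiv h qk (pderiv h qk f) x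

/-- `f` is of class `Cʳ` in the variable `x_h` alone, for all fixed values of the others. -/
def IsCIn {n : ℕ} (r : ℕ) (D : Set (Fin n → ℂ)) (h : Fin n) (f : (Fin n → ℍ[ℝ]) → ℍ[ℝ]) :
    Prop :=
  ∀ y ∈ circ D, ContDiffOn ℝ r (fun x : ℍ[ℝ] => f (Function.update y h x)) (section1 D h y)

/-- `f` is `x_h`-axially monogenic on `Ω_D`: a slice function of class `C¹(Ω_D)` with
`∂̄_{x_h} f = 0`. -/
def IsAxiallyMonogenic {n : ℕ} (D : Set (Fin n → ℂ)) (h : Fin n)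
    (f : (Fin n → ℍ[ℝ]) → ℍ[ℝ]) : Prop :=
  IsSlice D f ∧ ContDiffOn ℝ 1 f (circ D) ∧ ∀ x ∈ circ D, dbar h f x = 0

end SliceFueter

open SliceFueter

namespace SliceFueter

open Filter Topology Set

/-! ### Differentiation under the integral sign and strict differentiability -/

section Analysis

/-! Fix all variables but `x_m` and write the restriction of `f` as `A(α, s) + Im x · B(α, s)` with
`s = |Im x|²`. In these coordinates the Cauchy–Riemann equations read `∂_α A = B + 2s ∂_s B` and
`∂_α B = -2 ∂_s A`. With `A_k`, `B_k` the `k`-th `s`-derivatives, they become `∂_α A_k = (2k+1) B_k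
+ 2s B_{k+1}` and `∂_α B_k = -2 A_{k+1}` (`IsFueterSeq`). A direct computation gives `Δ_m f = 4 (A_1
+ Im x · B_1)`, and `∂̄` kills this because the coefficient `2k+1 = 3` at `k = 1` meets `i² + j² +
k² = -3` (`IsFueterSeq.lapl_eq`, `IsFueterSeq.dbar_lapl_eq_zero`).

That `A` and `B` are smooth in `(α, s)`, also at `s = 0`, comes from Cauchy's formula. Symmetrizing
`1/(ζ - z)` in `z` and its conjugate gives the kernels `u/(u² + s)` and `1/(u² + s)`, `u = ζ - α`,
which involve `β` only through `s = β²` (`IsHolPair.symmCauchy_eq`). All `s`-derivatives fall on the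
kernel, so `Δ_m f` is an integral of values of `f` on a circle. If `f` is `C¹` in all variables
jointly, so is `Δ_m f` (`IsSliceRegularIn.contDiffOn_lapl`).

Two points remain. That `Δ_m f` is slice in all variables cannot be read off by differentiating a
stem function, since none is known to be regular. Instead, for fixed `z` the functions `J ↦ ∑ J_K
c_K` form a finite-dimensional, hence closed, space, and `Δ_m f` is a pointwise limit of difference
quotients lying in it (`IsSliceRegularIn.isSlice_lapl`). That a `C¹` stem function induces a `C¹`
function is shown one variable at a time; the real points, where `J` is discontinuous, are handled
by parity (`contDiffOn_slice_param`, `IsSliceC1.contDiffOn`). -/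

theorem hasFDerivAt_intervalIntegral_of_continuousOn {X E : Type*} [NormedAddCommGroup X]
    [NormedSpace ℝ X] [NormedAddCommGroup E] [NormedSpace ℝ E]
    {O : Set X} (hO : IsOpen O) {h : X → ℝ → E} {h' : X → ℝ → X →L[ℝ] E} (a b : ℝ)
    (hc : ∀ q ∈ O, Continuous (h q))
    (hd : ∀ q ∈ O, ∀ t, HasFDerivAt (fun q => h q t) (h' q t) q)
    (hc' : ContinuousOn (Function.uncurry h') (O ×ˢ univ)) :
    (∀ q ∈ O, HasFDerivAt (fun q => ∫ t in a..b, h q t) (∫ t in a..b, h' q t) q) ∧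
      ContDiffOn ℝ 1 (fun q => ∫ t in a..b, h q t) O := by
  have hc'q : ∀ q ∈ O, Continuous (h' q) := fun q hq =>
    continuousOn_univ.1 <| hc'.comp (f := fun t : ℝ => (q, t)) (by fun_prop)
      (fun t _ => ⟨hq, mem_univ t⟩)
  -- Compactness of the interval makes `h'` continuous in `q` uniformly in `t`. This gives both the
  -- dominating bound and the continuity of the derivative.
  have key : ∀ q₀ ∈ O, ∀ ε > 0, ∀ᶠ q in 𝓝 q₀, q ∈ O ∧ ∀ t ∈ uIcc a b,
      ‖h' q t - h' q₀ t‖ < ε := by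
    intro q₀ hq₀ ε hε
    refine (hO.eventually_mem hq₀).and ?_
    refine isCompact_uIcc.eventually_forall_of_forall_eventually fun t _ => ?_
    have hat : ContinuousAt (Function.uncurry h') (q₀, t) :=
      hc'.continuousAt ((hO.prod isOpen_univ).mem_nhds ⟨hq₀, mem_univ t⟩)
    have h2 : ContinuousAt (fun z : X × ℝ => h' q₀ z.2) (q₀, t) :=
      ((hc'q q₀ hq₀).comp continuous_snd).continuousAt
    have h3 : ContinuousAt (fun z : X × ℝ => ‖h' z.1 z.2 - h' q₀ z.2‖) (q₀, t) :=
      (hat.sub h2).norm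
    have h4 := h3.tendsto.eventually_lt_const (u := ε) (by simpa using hε)
    exact h4
  have hder : ∀ q ∈ O, HasFDerivAt (fun q => ∫ t in a..b, h q t) (∫ t in a..b, h' q t) q := by
    intro q₀ hq₀
    refine intervalIntegral.hasFDerivAt_integral_of_dominated_of_fderiv_le
      (bound := fun t => ‖h' q₀ t‖ + 1) (key q₀ hq₀ 1 one_pos) ?_
      ((hc q₀ hq₀).intervalIntegrable _ _) (hc'q q₀ hq₀).aestronglyMeasurable ?_ ?_ ?_
    · filter_upwards [hO.mem_nhds hq₀] with q hq using (hc q hq).aestronglyMeasurable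
    · refine Eventually.of_forall fun t ht q hq => ?_
      have := hq.2 t (uIoc_subset_uIcc ht)
      have h2 := norm_le_norm_add_norm_sub' (h' q t) (h' q₀ t)
      linarith
    · exact ((hc'q q₀ hq₀).norm.add continuous_const).intervalIntegrable _ _
    · exact Eventually.of_forall fun t _ q hq => hd q hq.1 t
  refine ⟨hder, fun q₀ hq₀ => ContDiffAt.contDiffWithinAt ?_⟩
  refine contDiffAt_one_iff.2 ⟨_, O, hO.mem_nhds hq₀, ?_, hder⟩
  intro q₁ hq₁
  refine ContinuousAt.continuousWithinAt (Metric.continuousAt_iff'.2 fun ε hε => ?_)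
  have hε' : 0 < ε / (|b - a| + 1) := by positivity
  filter_upwards [key q₁ hq₁ _ hε'] with q hq
  rw [dist_eq_norm, ← intervalIntegral.integral_sub ((hc'q q hq.1).intervalIntegrable _ _)
    ((hc'q q₁ hq₁).intervalIntegrable _ _)]
  have h5 := intervalIntegral.norm_integral_le_of_norm_le_const
    (f := fun t => h' q t - h' q₁ t) (a := a) (b := b)
    (fun t ht => (hq.2 t (uIoc_subset_uIcc ht)).le)
  refine h5.trans_lt ?_
  rw [div_mul_eq_mul_div, div_lt_iff₀ (by positivity)]
  nlinarith [abs_nonneg (b - a)]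

theorem contDiffOn_intervalIntegral_of_contDiffOn {X E : Type*} [NormedAddCommGroup X]
    [NormedSpace ℝ X] [NormedAddCommGroup E] [NormedSpace ℝ E]
    {O : Set X} (hO : IsOpen O) {h : X → ℝ → E} (a b : ℝ)
    (hh : ContDiffOn ℝ 1 (Function.uncurry h) (O ×ˢ univ)) :
    ContDiffOn ℝ 1 (fun q => ∫ t in a..b, h q t) O := by
  have ho : IsOpen (O ×ˢ (univ : Set ℝ)) := hO.prod isOpen_univ
  refine (hasFDerivAt_intervalIntegral_of_continuousOn hO (h' := fun q t =>
    (fderiv ℝ (Function.uncurry h) (q, t)).comp (ContinuousLinearMap.inl ℝ X ℝ)) a b ?_ ?_ ?_).2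
  · intro q hq
    exact continuousOn_univ.1 <| hh.continuousOn.comp (f := fun t : ℝ => (q, t)) (by fun_prop)
      (fun t _ => ⟨hq, mem_univ t⟩)
  · intro q hq t
    have h1 : HasFDerivAt (Function.uncurry h) _ (q, t) :=
      ((hh.contDiffAt (ho.mem_nhds ⟨hq, mem_univ t⟩)).differentiableAt one_ne_zero).hasFDerivAt
    exact HasFDerivAt.comp (g := Function.uncurry h) (f := fun q => (q, t)) q h1
      (hasFDerivAt_prodMk_left q t)
  · have h2 := hh.continuousOn_fderiv_of_isOpen ho le_rfl
    exact (((ContinuousLinearMap.compL ℝ X (X × ℝ) E).flip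
      (ContinuousLinearMap.inl ℝ X ℝ)).continuous.comp_continuousOn h2)

/-- Strictness makes `f - f' x` Lipschitz with a small constant near `x`; its derivative `f' y - f'
x` at nearby `y` is bounded by that constant, so `f'` is continuous. -/
theorem contDiffOn_one_of_hasStrictFDerivAt {X E : Type*} [NormedAddCommGroup X]
    [NormedSpace ℝ X] [NormedAddCommGroup E] [NormedSpace ℝ E]
    {O : Set X} (hO : IsOpen O) {f : X → E} {f' : X → X →L[ℝ] E}
    (hf : ∀ x ∈ O, HasStrictFDerivAt f (f' x) x) : ContDiffOn ℝ 1 f O := by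
  intro x₀ hx₀
  refine ContDiffAt.contDiffWithinAt (contDiffAt_one_iff.2
    ⟨f', O, hO.mem_nhds hx₀, fun x hx => ?_, fun x hx => (hf x hx).hasFDerivAt⟩)
  refine ContinuousAt.continuousWithinAt (Metric.continuousAt_iff'.2 fun ε hε => ?_)
  have h1 := ((hf x hx).isLittleO.def (half_pos hε))
  rw [nhds_prod_eq] at h1
  obtain ⟨t, ht, h2⟩ := Filter.mem_prod_same_iff.1 h1
  filter_upwards [eventually_eventually_nhds.2 ht, hO.mem_nhds hx] with y hy hyO
  have h3 : HasFDerivAt (fun z => f z - f' x z) (f' y - f' x) y :=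
    (hf y hyO).hasFDerivAt.sub (f' x).hasFDerivAt
  rw [dist_eq_norm]
  refine lt_of_le_of_lt (h3.le_of_lip' (half_pos hε).le ?_) (half_lt_self hε)
  filter_upwards [hy] with z hz
  have := h2 (mk_mem_prod hz hy.self_of_nhds)
  have e : f z - f' x z - (f y - f' x y) = f z - f y - f' x (z - y) := by
    rw [map_sub]; abel
  rw [e]
  exact this

end Analysis

/-! ### Symmetrized Cauchy kernels and Cauchy's formula for stem functions -/

section Kernels

open Metric
open Complex (I)

/-- The `k`-th `s`-derivative of `u / (u² + s)` with `u = ζ - α`, at `q = (α, s)`. -/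
noncomputable def evenKernel (k : ℕ) (ζ : ℂ) (q : ℝ × ℝ) : ℂ :=
  (-1) ^ k * k.factorial * ((ζ - q.1) / ((ζ - q.1) ^ 2 + q.2) ^ (k + 1))

/-- The `k`-th `s`-derivative of `1 / (u² + s)` with `u = ζ - α`, at `q = (α, s)`. -/
noncomputable def oddKernel (k : ℕ) (ζ : ℂ) (q : ℝ × ℝ) : ℂ :=
  (-1) ^ k * k.factorial * (1 / ((ζ - q.1) ^ 2 + q.2) ^ (k + 1))

theorem hasFDerivAt_kernelDenom (ζ : ℂ) (q : ℝ × ℝ) :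
    HasFDerivAt (fun q : ℝ × ℝ => (ζ - q.1) ^ 2 + (q.2 : ℂ))
      ((ContinuousLinearMap.fst ℝ ℝ ℝ).smulRight (-2 * (ζ - q.1))
        + (ContinuousLinearMap.snd ℝ ℝ ℝ).smulRight 1) q := by
  have h1 : HasFDerivAt (fun q : ℝ × ℝ => (q.1 : ℂ))
      (Complex.ofRealCLM.comp (ContinuousLinearMap.fst ℝ ℝ ℝ)) q :=
    (Complex.ofRealCLM.comp (ContinuousLinearMap.fst ℝ ℝ ℝ)).hasFDerivAt
  have h2 : HasFDerivAt (fun q : ℝ × ℝ => (q.2 : ℂ))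
      (Complex.ofRealCLM.comp (ContinuousLinearMap.snd ℝ ℝ ℝ)) q :=
    (Complex.ofRealCLM.comp (ContinuousLinearMap.snd ℝ ℝ ℝ)).hasFDerivAt
  have h3 := ((h1.const_sub ζ).pow 2).add h2
  refine h3.congr_fderiv ?_
  ext <;> simp

theorem hasFDerivAt_oddKernel (k : ℕ) (ζ : ℂ) (q : ℝ × ℝ) (hq : (ζ - q.1) ^ 2 + q.2 ≠ 0) :
    HasFDerivAt (oddKernel k ζ)
      ((ContinuousLinearMap.fst ℝ ℝ ℝ).smulRight (-2 * evenKernel (k + 1) ζ q)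
        + (ContinuousLinearMap.snd ℝ ℝ ℝ).smulRight (oddKernel (k + 1) ζ q)) q := by
  have h1 := hasFDerivAt_kernelDenom ζ q
  have h2 : HasDerivAt (fun w : ℂ => (-1 : ℂ) ^ k * k.factorial * (1 / w ^ (k + 1))) _ _ :=
    (((hasDerivAt_pow (k + 1) ((ζ - q.1) ^ 2 + (q.2 : ℂ))).fun_inv (pow_ne_zero _ hq)).const_mul
      ((-1 : ℂ) ^ k * k.factorial)).congr_of_eventuallyEq
      (Eventually.of_forall fun w => by simp)
  have h3 := h2.comp_hasFDerivAt q h1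
  refine h3.congr_fderiv ?_
  ext <;> simp [evenKernel, oddKernel, Nat.factorial_succ] <;> (field_simp; ring)

/-- The even kernel is `u` times the odd one. Replacing the resulting `u²` by `(u² + s) - s` leads
back to odd kernels and produces the coefficients `2k + 1` and `2s`. -/
theorem hasFDerivAt_evenKernel (k : ℕ) (ζ : ℂ) (q : ℝ × ℝ) (hq : (ζ - q.1) ^ 2 + q.2 ≠ 0) :
    HasFDerivAt (evenKernel k ζ)
      ((ContinuousLinearMap.fst ℝ ℝ ℝ).smulRight
          ((2 * k + 1) * oddKernel k ζ q + 2 * q.2 * oddKernel (k + 1) ζ q)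
        + (ContinuousLinearMap.snd ℝ ℝ ℝ).smulRight (evenKernel (k + 1) ζ q)) q := by
  have h1 : HasFDerivAt (fun q : ℝ × ℝ => (q.1 : ℂ))
      (Complex.ofRealCLM.comp (ContinuousLinearMap.fst ℝ ℝ ℝ)) q :=
    (Complex.ofRealCLM.comp (ContinuousLinearMap.fst ℝ ℝ ℝ)).hasFDerivAt
  have h2 := (h1.const_sub ζ).mul (hasFDerivAt_oddKernel k ζ q hq)
  refine (h2.congr_of_eventuallyEq (Eventually.of_forall fun q => ?_)).congr_fderiv ?_
  · simp only [evenKernel, oddKernel, Pi.mul_apply]; ring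
  · ext <;> simp [evenKernel, oddKernel, Nat.factorial_succ] <;> field_simp
    ring

/-- The pairs `q = (α, s)` at which no kernel has a pole on the circle `C(z₀, r)`. -/
def kernelDomain (z₀ : ℂ) (r : ℝ) : Set (ℝ × ℝ) :=
  {q | ∀ ζ ∈ sphere z₀ r, (ζ - q.1) ^ 2 + q.2 ≠ 0}

theorem isOpen_kernelDomain (z₀ : ℂ) (r : ℝ) : IsOpen (kernelDomain z₀ r) := by
  rw [isOpen_iff_eventually]
  intro q hq
  refine (isCompact_sphere z₀ r).eventually_forall_of_forall_eventually fun ζ hζ => ?_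
  have hc : ContinuousAt (fun z : (ℝ × ℝ) × ℂ => (z.2 - z.1.1) ^ 2 + (z.1.2 : ℂ)) (q, ζ) := by
    fun_prop
  exact hc.eventually_ne (hq ζ hζ)

variable {E : Type*} [NormedAddCommGroup E] [NormedSpace ℝ E]

/-- The real part of the Cauchy integral over `C(z₀, r)` of `κ` times `g₀ + i g₁`, doubled when the
conjugate circle is a different one. -/
noncomputable def symmCauchy (z₀ : ℂ) (r : ℝ) (g₀ g₁ : ℂ → E) (κ : ℂ → ℂ) : E :=
  ((if z₀.im = 0 then 1 else 2) / (2 * Real.pi)) • ∫ θ in (0 : ℝ)..(2 * Real.pi),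
    ((κ (circleMap z₀ r θ) * circleMap 0 r θ).re • g₀ (circleMap z₀ r θ)
      - (κ (circleMap z₀ r θ) * circleMap 0 r θ).im • g₁ (circleMap z₀ r θ))

/-- `g₀ + i g₁` is a holomorphic stem function of one variable on `U`. -/
structure IsHolPair (U : Set ℂ) (g₀ g₁ : ℂ → E) : Prop where
  isOpen : IsOpen U
  even : ContDiffOn ℝ 1 g₀ U
  odd : ContDiffOn ℝ 1 g₁ U
  cr_one : ∀ z ∈ U, fderiv ℝ g₀ z 1 = fderiv ℝ g₁ z I
  cr_I : ∀ z ∈ U, fderiv ℝ g₀ z I = -fderiv ℝ g₁ z 1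
  conj_mem : ∀ z ∈ U, (starRingEnd ℂ) z ∈ U
  even_conj : ∀ z ∈ U, g₀ ((starRingEnd ℂ) z) = g₀ z
  odd_conj : ∀ z ∈ U, g₁ ((starRingEnd ℂ) z) = -g₁ z

variable {U : Set ℂ} {g₀ g₁ : ℂ → E}

theorem IsHolPair.hasFDerivAt (h : IsHolPair U g₀ g₁) {z : ℂ} (hz : z ∈ U) :
    HasFDerivAt g₀ (fderiv ℝ g₀ z) z ∧ HasFDerivAt g₁ (fderiv ℝ g₁ z) z :=
  ⟨((h.even.contDiffAt (h.isOpen.mem_nhds hz)).differentiableAt one_ne_zero).hasFDerivAt,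
   ((h.odd.contDiffAt (h.isOpen.mem_nhds hz)).differentiableAt one_ne_zero).hasFDerivAt⟩

/-- The space `E` is only real; real functionals reduce Cauchy's formula to complex-valued
holomorphic functions. -/
theorem IsHolPair.differentiableOn (h : IsHolPair U g₀ g₁) (l : E →L[ℝ] ℝ) :
    DifferentiableOn ℂ (fun z => (l (g₀ z) : ℂ) + l (g₁ z) * I) U := by
  intro z hz
  obtain ⟨h0, h1⟩ := h.hasFDerivAt hz
  have h2 : HasFDerivAt (fun z => (l (g₀ z) : ℂ) + l (g₁ z) * I)
      (Complex.ofRealCLM.comp (l.comp (fderiv ℝ g₀ z))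
        + (Complex.ofRealCLM.comp (l.comp (fderiv ℝ g₁ z))).smulRight I) z := by
    have h0' := Complex.ofRealCLM.hasFDerivAt.comp z (l.hasFDerivAt.comp z h0)
    have h1' := Complex.ofRealCLM.hasFDerivAt.comp z (l.hasFDerivAt.comp z h1)
    exact h0'.add (h1'.smul_const I)
  refine DifferentiableAt.differentiableWithinAt
    (differentiableAt_complex_iff_differentiableAt_real.2 ⟨h2.differentiableAt, ?_⟩)
  rw [h2.fderiv]
  simp only [_root_.add_apply, ContinuousLinearMap.comp_apply,
    ContinuousLinearMap.smulRight_apply, h.cr_one z hz, h.cr_I z hz]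
  apply Complex.ext <;> simp

/-- On the circle `dζ = i · circleMap 0 r θ dθ`, so the `i` cancels that of `2πi`, and taking real
parts leaves an integral that makes sense in `E`. -/
theorem apply_symmCauchy (l : E →L[ℝ] ℝ) [CompleteSpace E] (z₀ : ℂ) {r : ℝ} {κ : ℂ → ℂ}
    (hr : 0 < r)
    (h0 : ContinuousOn g₀ (sphere z₀ r)) (h1 : ContinuousOn g₁ (sphere z₀ r))
    (hκ : ContinuousOn κ (sphere z₀ r)) {v : ℂ}
    (hv : circleIntegral (fun z => κ z * ((l (g₀ z) : ℂ) + l (g₁ z) * I)) z₀ r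
      = 2 * Real.pi * I * v) :
    l (symmCauchy z₀ r g₀ g₁ κ) = (if z₀.im = 0 then 1 else 2) * v.re := by
  have hm : ∀ θ : ℝ, circleMap z₀ r θ ∈ sphere z₀ r := circleMap_mem_sphere z₀ hr.le
  have hcm : Continuous fun θ : ℝ => circleMap z₀ r θ := continuous_circleMap z₀ r
  have c0 : Continuous fun θ : ℝ => g₀ (circleMap z₀ r θ) := h0.comp_continuous hcm hm
  have c1 : Continuous fun θ : ℝ => g₁ (circleMap z₀ r θ) := h1.comp_continuous hcm hm
  have cκ : Continuous fun θ : ℝ => κ (circleMap z₀ r θ) := hκ.comp_continuous hcm hm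
  have cz : Continuous fun θ : ℝ => circleMap 0 r θ := continuous_circleMap 0 r
  set W : ℝ → ℂ := fun θ => κ (circleMap z₀ r θ) * circleMap 0 r θ with hW
  have cW : Continuous W := cκ.mul cz
  set Φ : ℝ → ℂ := fun θ => (l (g₀ (circleMap z₀ r θ)) : ℂ) + l (g₁ (circleMap z₀ r θ)) * I
  have cΦ : Continuous Φ := (Complex.continuous_ofReal.comp (l.continuous.comp c0)).add
    ((Complex.continuous_ofReal.comp (l.continuous.comp c1)).mul continuous_const)
  have e1 : circleIntegral (fun z => κ z * ((l (g₀ z) : ℂ) + l (g₁ z) * I)) z₀ r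
      = I * ∫ θ in (0 : ℝ)..(2 * Real.pi), W θ * Φ θ := by
    rw [circleIntegral, ← intervalIntegral.integral_const_mul]
    refine intervalIntegral.integral_congr fun θ _ => ?_
    simp only [deriv_circleMap, smul_eq_mul, hW, Φ]
    ring
  have e2 : ∫ θ in (0 : ℝ)..(2 * Real.pi), W θ * Φ θ = 2 * Real.pi * v := by
    have := e1.symm.trans hv
    exact mul_left_cancel₀ Complex.I_ne_zero (this.trans (by ring))
  have e3 : l (∫ θ in (0 : ℝ)..(2 * Real.pi),
      ((W θ).re • g₀ (circleMap z₀ r θ) - (W θ).im • g₁ (circleMap z₀ r θ)))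
      = 2 * Real.pi * v.re := by
    rw [← ContinuousLinearMap.intervalIntegral_comp_comm]
    · have : (∫ θ in (0 : ℝ)..(2 * Real.pi), Complex.reCLM (W θ * Φ θ))
          = Complex.reCLM (∫ θ in (0 : ℝ)..(2 * Real.pi), W θ * Φ θ) :=
        ContinuousLinearMap.intervalIntegral_comp_comm _ ((cW.mul cΦ).intervalIntegrable _ _)
      rw [e2] at this
      have h4 : Complex.reCLM (2 * Real.pi * v) = 2 * Real.pi * v.re := by simp
      rw [← h4, ← this]
      refine intervalIntegral.integral_congr fun θ _ => ?_
      simp [Φ]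
    · exact (((Complex.continuous_re.comp cW).smul c0).sub
        ((Complex.continuous_im.comp cW).smul c1)).intervalIntegrable _ _
  rw [symmCauchy, map_smul, e3, smul_eq_mul]
  field_simp

theorem sub_re_sq_add_im_sq (ζ z : ℂ) :
    (ζ - (z.re : ℂ)) ^ 2 + ((z.im ^ 2 : ℝ) : ℂ) = (ζ - z) * (ζ - (starRingEnd ℂ) z) := by
  have h1 : (starRingEnd ℂ) z = z.re - z.im * I := by apply Complex.ext <;> simp
  have h2 : z = z.re + z.im * I := (Complex.re_add_im z).symm
  rw [h1]
  conv_rhs => enter [1]; rw [h2]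
  push_cast
  linear_combination ((z.im : ℂ) ^ 2) * Complex.I_sq

/-- A disc with real centre is symmetric under conjugation, while one with `r < |Im z₀|` lies in an
open half plane and misses its conjugate. In both cases neither pole lies on the circle. -/
theorem mem_kernelDomain {z₀ z : ℂ} {r : ℝ} (hr : z₀.im ≠ 0 → r < |z₀.im|)
    (hz : z ∈ ball z₀ r) :
    ((z.re, z.im ^ 2) : ℝ × ℝ) ∈ kernelDomain z₀ r ∧
    (∀ ζ ∈ sphere z₀ r, ζ - z ≠ 0 ∧ ζ - (starRingEnd ℂ) z ≠ 0) ∧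
    (z₀.im = 0 → (starRingEnd ℂ) z ∈ ball z₀ r) ∧
    (z₀.im ≠ 0 → (starRingEnd ℂ) z ∉ closedBall z₀ r) := by
  have a1 : z₀.im = 0 → (starRingEnd ℂ) z ∈ ball z₀ r := by
    intro h
    have : (starRingEnd ℂ) z₀ = z₀ := Complex.conj_eq_iff_im.2 h
    rw [mem_ball, dist_eq_norm, ← this, ← map_sub, Complex.norm_conj, ← dist_eq_norm]
    exact hz
  have a2 : z₀.im ≠ 0 → (starRingEnd ℂ) z ∉ closedBall z₀ r := by
    intro h hc
    have h1 := hr h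
    rw [mem_closedBall, dist_eq_norm] at hc
    rw [mem_ball, dist_eq_norm] at hz
    have h2 := (Complex.abs_im_le_norm _).trans hc
    have h3 := (Complex.abs_im_le_norm _).trans_lt hz
    simp only [Complex.sub_im, Complex.conj_im] at h2 h3
    rw [abs_le] at h2
    rw [abs_lt] at h3
    rcases abs_cases z₀.im with ⟨e, _⟩ | ⟨e, _⟩ <;> linarith
  have a3 : ∀ ζ ∈ sphere z₀ r, ζ - z ≠ 0 ∧ ζ - (starRingEnd ℂ) z ≠ 0 := by
    intro ζ hζ
    constructor
    · intro h
      rw [sub_eq_zero.1 h, mem_sphere] at hζ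
      rw [mem_ball] at hz
      linarith
    · intro h
      rw [sub_eq_zero.1 h] at hζ
      by_cases h0 : z₀.im = 0
      · have := a1 h0
        rw [mem_ball] at this
        rw [mem_sphere] at hζ
        linarith
      · exact a2 h0 (sphere_subset_closedBall hζ)
  refine ⟨fun ζ hζ => ?_, a3, a1, a2⟩
  rw [sub_re_sq_add_im_sq]
  exact mul_ne_zero (a3 ζ hζ).1 (a3 ζ hζ).2

/-- Partial fractions: the even kernel is half the sum of the Cauchy kernels at `z` and its
conjugate, the odd one their difference divided by `2iβ`. -/
theorem IsHolPair.symmCauchy_eq [CompleteSpace E] (h : IsHolPair U g₀ g₁) {z₀ z : ℂ} {r : ℝ}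
    (hU : closedBall z₀ r ⊆ U)
    (hr : z₀.im ≠ 0 → r < |z₀.im|) (hz : z ∈ ball z₀ r) :
    symmCauchy z₀ r g₀ g₁ (fun ζ => evenKernel 0 ζ (z.re, z.im ^ 2)) = g₀ z ∧
    z.im • symmCauchy z₀ r g₀ g₁ (fun ζ => oddKernel 0 ζ (z.re, z.im ^ 2)) = g₁ z := by
  obtain ⟨hd, hne, ha, hb⟩ := mem_kernelDomain hr hz
  have hr0 : 0 < r := pos_of_mem_ball hz
  have hzU : z ∈ U := hU (ball_subset_closedBall hz)
  have hsU : sphere z₀ r ⊆ U := sphere_subset_closedBall.trans hU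
  have c0 : ContinuousOn g₀ (sphere z₀ r) := h.even.continuousOn.mono hsU
  have c1 : ContinuousOn g₁ (sphere z₀ r) := h.odd.continuousOn.mono hsU
  have hre : (z.re : ℂ) = (z + (starRingEnd ℂ) z) / 2 := Complex.re_eq_add_conj z
  have cz : ContinuousOn (fun ζ => (ζ - z)⁻¹) (sphere z₀ r) :=
    ContinuousOn.inv₀ (by fun_prop) fun ζ hζ => (hne ζ hζ).1
  have cz' : ContinuousOn (fun ζ => (ζ - (starRingEnd ℂ) z)⁻¹) (sphere z₀ r) :=
    ContinuousOn.inv₀ (by fun_prop) fun ζ hζ => (hne ζ hζ).2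
  have ce : ContinuousOn (fun ζ => evenKernel 0 ζ (z.re, z.im ^ 2)) (sphere z₀ r) := by
    simp only [evenKernel]
    refine ContinuousOn.mul (by fun_prop) (ContinuousOn.div (by fun_prop) (by fun_prop) ?_)
    intro ζ hζ
    exact pow_ne_zero _ (hd ζ hζ)
  have co : ContinuousOn (fun ζ => oddKernel 0 ζ (z.re, z.im ^ 2)) (sphere z₀ r) := by
    simp only [oddKernel]
    refine ContinuousOn.mul (by fun_prop) (ContinuousOn.div (by fun_prop) (by fun_prop) ?_)
    intro ζ hζ
    exact pow_ne_zero _ (hd ζ hζ)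
  have main : ∀ l : E →L[ℝ] ℝ,
      l (symmCauchy z₀ r g₀ g₁ (fun ζ => evenKernel 0 ζ (z.re, z.im ^ 2))) = l (g₀ z) ∧
      (z.im ≠ 0 → z.im * l (symmCauchy z₀ r g₀ g₁ (fun ζ => oddKernel 0 ζ (z.re, z.im ^ 2)))
        = l (g₁ z)) := by
    intro l
    have hφ := (h.differentiableOn l).mono hU
    set φ : ℂ → ℂ := fun z => (l (g₀ z) : ℂ) + l (g₁ z) * I with hφd
    have hφc : ContinuousOn φ (sphere z₀ r) := hφ.continuousOn.mono sphere_subset_closedBall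
    have hconj : φ ((starRingEnd ℂ) z) = (starRingEnd ℂ) (φ z) := by
      simp [hφd, h.even_conj z hzU, h.odd_conj z hzU]
    have i1 : circleIntegral (fun ζ => (ζ - z)⁻¹ * φ ζ) z₀ r = 2 * Real.pi * I * φ z :=
      hφ.circleIntegral_sub_inv_smul hz
    -- The pole at the conjugate point contributes the conjugate of `φ z` if it lies inside the
    -- circle, and nothing otherwise. In the second case the factor `2` in `symmCauchy` makes up for
    -- the missing half.
    obtain ⟨w, hw, i2⟩ : ∃ w : ℂ, ((z₀.im = 0 → w = (starRingEnd ℂ) (φ z)) ∧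
        (z₀.im ≠ 0 → w = 0)) ∧ circleIntegral (fun ζ => (ζ - (starRingEnd ℂ) z)⁻¹ * φ ζ) z₀ r
          = 2 * Real.pi * I * w := by
      by_cases h0 : z₀.im = 0
      · refine ⟨(starRingEnd ℂ) (φ z), ⟨fun _ => rfl, fun h' => absurd h0 h'⟩, ?_⟩
        rw [← hconj]
        exact hφ.circleIntegral_sub_inv_smul (ha h0)
      · refine ⟨0, ⟨fun h' => absurd h' h0, fun _ => rfl⟩, ?_⟩
        rw [mul_zero]
        have hdf : DifferentiableOn ℂ (fun ζ => (ζ - (starRingEnd ℂ) z)⁻¹ * φ ζ)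
            (closedBall z₀ r) := by
          refine DifferentiableOn.mul (DifferentiableOn.inv (by fun_prop) ?_) hφ
          intro ζ hζ h'
          rw [sub_eq_zero.1 h'] at hζ
          exact hb h0 hζ
        exact (hdf.mono closure_ball_subset_closedBall).diffContOnCl.circleIntegral_eq_zero hr0.le
    have k1 : CircleIntegrable (fun ζ => (ζ - z)⁻¹ * φ ζ) z₀ r :=
      (cz.mul hφc).circleIntegrable hr0.le
    have k2 : CircleIntegrable (fun ζ => (ζ - (starRingEnd ℂ) z)⁻¹ * φ ζ) z₀ r :=
      (cz'.mul hφc).circleIntegrable hr0.le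
    constructor
    · rw [apply_symmCauchy l z₀ hr0 c0 c1 ce (v := (φ z + w) / 2)]
      · by_cases h0 : z₀.im = 0
        · simp [h0, hw.1 h0, hφd]
        · simp [h0, hw.2 h0, hφd]; ring
      · have : circleIntegral (fun ζ => evenKernel 0 ζ (z.re, z.im ^ 2) * φ ζ) z₀ r
            = circleIntegral (fun ζ => (1 / 2 : ℂ) * ((ζ - z)⁻¹ * φ ζ
              + (ζ - (starRingEnd ℂ) z)⁻¹ * φ ζ)) z₀ r := by
          refine circleIntegral.integral_congr hr0.le fun ζ hζ => ?_
          obtain ⟨n1, n2⟩ := hne ζ hζ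
          simp only [evenKernel, zero_add, pow_one, sub_re_sq_add_im_sq, pow_zero,
            Nat.factorial_zero, Nat.cast_one]
          rw [hre]
          field_simp
          ring
        rw [this, circleIntegral.integral_const_mul, circleIntegral.integral_add k1 k2, i1, i2]
        ring
    · intro hβ
      rw [apply_symmCauchy l z₀ hr0 c0 c1 co (v := (φ z - w) / (2 * z.im * I))]
      · have e : ∀ x : ℂ, (x / (2 * z.im * I)).re = x.im / (2 * z.im) := by
          intro x
          have : x / (2 * z.im * I) = -(x * I) / ((2 * z.im : ℝ) : ℂ) := by
            push_cast
            field_simp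
            rw [Complex.I_sq]; ring
          rw [this, Complex.div_ofReal_re]
          simp
        rw [e]
        by_cases h0 : z₀.im = 0
        · simp [h0, hw.1 h0, hφd]; field_simp; ring
        · simp [h0, hw.2 h0, hφd]; field_simp
      · have hβ' : (z.im : ℂ) ≠ 0 := by exact_mod_cast hβ
        have hsub : z - (starRingEnd ℂ) z = 2 * z.im * I := by
          rw [Complex.sub_conj]; push_cast; ring
        have : circleIntegral (fun ζ => oddKernel 0 ζ (z.re, z.im ^ 2) * φ ζ) z₀ r
            = circleIntegral (fun ζ => (1 / (2 * z.im * I) : ℂ) * ((ζ - z)⁻¹ * φ ζ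
              - (ζ - (starRingEnd ℂ) z)⁻¹ * φ ζ)) z₀ r := by
          refine circleIntegral.integral_congr hr0.le fun ζ hζ => ?_
          obtain ⟨n1, n2⟩ := hne ζ hζ
          have n3 : z - (starRingEnd ℂ) z ≠ 0 := by
            rw [hsub]; simp [hβ]
          simp only [oddKernel, zero_add, pow_one, sub_re_sq_add_im_sq, ← hsub, pow_zero,
            Nat.factorial_zero, Nat.cast_one]
          field_simp
          simp
        rw [this, circleIntegral.integral_const_mul, circleIntegral.integral_sub k1 k2, i1, i2]
        ring
  constructor
  · rw [SeparatingDual.eq_iff_forall_dual_eq (R := ℝ)]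
    exact fun l => (main l).1
  -- At a real point the division by `2iβ` is impossible, but both sides vanish there because `g₁`
  -- is odd.
  · by_cases hβ : z.im = 0
    · have h1 := h.odd_conj z hzU
      rw [Complex.conj_eq_iff_im.2 hβ] at h1
      have h2 : (2 : ℝ) • g₁ z = 0 := by
        rw [two_smul]; nth_rewrite 1 [h1]; simp
      rw [hβ, zero_smul]
      exact ((smul_eq_zero.1 h2).resolve_left two_ne_zero).symm
    · rw [SeparatingDual.eq_iff_forall_dual_eq (R := ℝ)]
      intro l
      rw [map_smul, smul_eq_mul]
      exact (main l).2 hβ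

end Kernels

/-! ### Iterated derivatives in `s` and their Cauchy integrals -/

section FueterSeq

open Metric

variable {E : Type*} [NormedAddCommGroup E] [NormedSpace ℝ E]

/-- Successive `s`-derivatives `(A k, B k)` of a pair for which `A (α, β²) + i β B (α, β²)` is
holomorphic in `α + iβ`. -/
structure IsFueterSeq (V : Set (ℝ × ℝ)) (A B : ℕ → ℝ × ℝ → E) : Prop where
  isOpen : IsOpen V
  even : ∀ k, ∀ q ∈ V, HasFDerivAt (A k)
    ((ContinuousLinearMap.fst ℝ ℝ ℝ).smulRight ((2 * k + 1 : ℝ) • B k q + (2 * q.2) • B (k + 1) q)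
      + (ContinuousLinearMap.snd ℝ ℝ ℝ).smulRight (A (k + 1) q)) q
  odd : ∀ k, ∀ q ∈ V, HasFDerivAt (B k)
    ((ContinuousLinearMap.fst ℝ ℝ ℝ).smulRight ((-2 : ℝ) • A (k + 1) q)
      + (ContinuousLinearMap.snd ℝ ℝ ℝ).smulRight (B (k + 1) q)) q

/-- Bootstrapping: the derivative of each member is built from members of the family with polynomial
coefficients, so induction on `r`, for all `k` at once, gives every order of smoothness. -/
theorem IsFueterSeq.contDiffAt {V : Set (ℝ × ℝ)} {A B : ℕ → ℝ × ℝ → E} (h : IsFueterSeq V A B)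
    (r : ℕ) : ∀ k, ∀ q ∈ V, ContDiffAt ℝ r (A k) q ∧ ContDiffAt ℝ r (B k) q := by
  induction r with
  | zero =>
    intro k q hq
    simp only [Nat.cast_zero]
    constructor
    · exact contDiffAt_zero.2 ⟨V, h.isOpen.mem_nhds hq, fun p hp =>
        (h.even k p hp).continuousAt.continuousWithinAt⟩
    · exact contDiffAt_zero.2 ⟨V, h.isOpen.mem_nhds hq, fun p hp =>
        (h.odd k p hp).continuousAt.continuousWithinAt⟩
  | succ r ih =>
    intro k q hq
    have hL : ∀ (L : ℝ × ℝ →L[ℝ] ℝ) {f : ℝ × ℝ → E}, ContDiffAt ℝ r f q →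
        ContDiffAt ℝ r (fun p => L.smulRight (f p)) q := fun L f hf =>
      (ContinuousLinearMap.smulRightL ℝ (ℝ × ℝ) E L).contDiff.contDiffAt.comp q hf
    push_cast
    constructor
    · refine contDiffAt_succ_iff_hasFDerivAt.2
        ⟨_, ⟨V, h.isOpen.mem_nhds hq, fun p hp => h.even k p hp⟩, ?_⟩
      refine (hL _ ?_).add (hL _ (ih (k + 1) q hq).1)
      refine ContDiffAt.add (contDiffAt_const.smul (ih k q hq).2)
        (ContDiffAt.smul (by fun_prop) (ih (k + 1) q hq).2)
    · refine contDiffAt_succ_iff_hasFDerivAt.2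
        ⟨_, ⟨V, h.isOpen.mem_nhds hq, fun p hp => h.odd k p hp⟩, ?_⟩
      exact (hL _ (contDiffAt_const.smul (ih (k + 1) q hq).1)).add (hL _ (ih (k + 1) q hq).2)

theorem contDiffOn_oddKernel (k : ℕ) (z₀ : ℂ) {r : ℝ} (hr : 0 ≤ r) :
    ContDiffOn ℝ 1 (fun p : (ℝ × ℝ) × ℝ => oddKernel k (circleMap z₀ r p.2) p.1)
      (kernelDomain z₀ r ×ˢ univ) := by
  have hc : ContDiff ℝ 1 fun p : (ℝ × ℝ) × ℝ => circleMap z₀ r p.2 :=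
    (contDiff_circleMap z₀ r).comp contDiff_snd
  have h1 : ContDiff ℝ 1 fun p : (ℝ × ℝ) × ℝ => ((p.1.1 : ℝ) : ℂ) :=
    Complex.ofRealCLM.contDiff.comp (by fun_prop)
  have h2 : ContDiff ℝ 1 fun p : (ℝ × ℝ) × ℝ => ((p.1.2 : ℝ) : ℂ) :=
    Complex.ofRealCLM.contDiff.comp (by fun_prop)
  refine contDiffOn_const.mul (contDiffOn_const.mul ?_ |>.congr fun p _ => div_eq_mul_inv _ _)
  refine ContDiffOn.inv ((((hc.sub h1).pow 2).add h2).pow (k + 1)).contDiffOn ?_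
  exact fun p hp => pow_ne_zero _ (hp.1 _ (circleMap_mem_sphere z₀ hr p.2))

theorem contDiffOn_evenKernel (k : ℕ) (z₀ : ℂ) {r : ℝ} (hr : 0 ≤ r) :
    ContDiffOn ℝ 1 (fun p : (ℝ × ℝ) × ℝ => evenKernel k (circleMap z₀ r p.2) p.1)
      (kernelDomain z₀ r ×ˢ univ) := by
  have hc : ContDiff ℝ 1 fun p : (ℝ × ℝ) × ℝ => circleMap z₀ r p.2 :=
    (contDiff_circleMap z₀ r).comp contDiff_snd
  have h1 : ContDiff ℝ 1 fun p : (ℝ × ℝ) × ℝ => ((p.1.1 : ℝ) : ℂ) :=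
    Complex.ofRealCLM.contDiff.comp (by fun_prop)
  refine ((hc.sub h1).contDiffOn.mul (contDiffOn_oddKernel k z₀ hr)).congr fun p _ => ?_
  simp only [evenKernel, oddKernel]
  ring

/-- The integrand of `symmCauchy`. -/
noncomputable def symmCauchyIntegrand (z₀ : ℂ) (r : ℝ) (g₀ g₁ : ℂ → E) (κ : ℂ → ℂ) (θ : ℝ) : E :=
  (κ (circleMap z₀ r θ) * circleMap 0 r θ).re • g₀ (circleMap z₀ r θ)
    - (κ (circleMap z₀ r θ) * circleMap 0 r θ).im • g₁ (circleMap z₀ r θ)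

theorem symmCauchy_eq_integral (z₀ : ℂ) (r : ℝ) (g₀ g₁ : ℂ → E) (κ : ℂ → ℂ) :
    symmCauchy z₀ r g₀ g₁ κ = ((if z₀.im = 0 then 1 else 2) / (2 * Real.pi)) •
      ∫ θ in (0 : ℝ)..(2 * Real.pi), symmCauchyIntegrand z₀ r g₀ g₁ κ θ := rfl

theorem continuous_symmCauchyIntegrand {z₀ : ℂ} {r : ℝ} (hr : 0 ≤ r) {g₀ g₁ : ℂ → E}
    (h0 : ContinuousOn g₀ (sphere z₀ r)) (h1 : ContinuousOn g₁ (sphere z₀ r))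
    {X : Type*} [TopologicalSpace X] {O : Set X} {κ : X → ℂ → ℂ}
    (hκ : ContinuousOn (fun p : X × ℝ => κ p.1 (circleMap z₀ r p.2)) (O ×ˢ univ)) :
    ContinuousOn (fun p : X × ℝ => symmCauchyIntegrand z₀ r g₀ g₁ (κ p.1) p.2) (O ×ˢ univ) := by
  have hcm : Continuous fun p : X × ℝ => circleMap z₀ r p.2 :=
    (continuous_circleMap z₀ r).comp continuous_snd
  have hcm0 : Continuous fun p : X × ℝ => circleMap 0 r p.2 :=
    (continuous_circleMap 0 r).comp continuous_snd
  have c0 : Continuous fun p : X × ℝ => g₀ (circleMap z₀ r p.2) :=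
    h0.comp_continuous hcm fun p => circleMap_mem_sphere z₀ hr p.2
  have c1 : Continuous fun p : X × ℝ => g₁ (circleMap z₀ r p.2) :=
    h1.comp_continuous hcm fun p => circleMap_mem_sphere z₀ hr p.2
  have cW := hκ.mul hcm0.continuousOn
  exact ((Complex.continuous_re.comp_continuousOn cW).smul c0.continuousOn).sub
    ((Complex.continuous_im.comp_continuousOn cW).smul c1.continuousOn)

theorem continuous_symmCauchyIntegrand_right {z₀ : ℂ} {r : ℝ} (hr : 0 ≤ r) {g₀ g₁ : ℂ → E}
    (h0 : ContinuousOn g₀ (sphere z₀ r)) (h1 : ContinuousOn g₁ (sphere z₀ r))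
    {X : Type*} [TopologicalSpace X] {O : Set X} {κ : X → ℂ → ℂ}
    (hκ : ContinuousOn (fun p : X × ℝ => κ p.1 (circleMap z₀ r p.2)) (O ×ˢ univ))
    {x : X} (hx : x ∈ O) : Continuous (symmCauchyIntegrand z₀ r g₀ g₁ (κ x)) :=
  continuousOn_univ.1 <| (continuous_symmCauchyIntegrand hr h0 h1 hκ).comp
    (f := fun t : ℝ => (x, t)) (by fun_prop) (fun t _ => ⟨hx, mem_univ t⟩)

theorem hasFDerivAt_symmCauchy [CompleteSpace E] {z₀ : ℂ} {r : ℝ} (hr : 0 ≤ r) {g₀ g₁ : ℂ → E}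
    (h0 : ContinuousOn g₀ (sphere z₀ r)) (h1 : ContinuousOn g₁ (sphere z₀ r))
    {V : Set (ℝ × ℝ)} (hV : IsOpen V) {κ κ₁ κ₂ : ℝ × ℝ → ℂ → ℂ}
    (hκ : ContinuousOn (fun p : (ℝ × ℝ) × ℝ => κ p.1 (circleMap z₀ r p.2)) (V ×ˢ univ))
    (hκ₁ : ContinuousOn (fun p : (ℝ × ℝ) × ℝ => κ₁ p.1 (circleMap z₀ r p.2)) (V ×ˢ univ))
    (hκ₂ : ContinuousOn (fun p : (ℝ × ℝ) × ℝ => κ₂ p.1 (circleMap z₀ r p.2)) (V ×ˢ univ))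
    (hd : ∀ q ∈ V, ∀ ζ ∈ sphere z₀ r, HasFDerivAt (fun q => κ q ζ)
      ((ContinuousLinearMap.fst ℝ ℝ ℝ).smulRight (κ₁ q ζ)
        + (ContinuousLinearMap.snd ℝ ℝ ℝ).smulRight (κ₂ q ζ)) q) :
    ∀ q ∈ V, HasFDerivAt (fun q => symmCauchy z₀ r g₀ g₁ (κ q))
      ((ContinuousLinearMap.fst ℝ ℝ ℝ).smulRight (symmCauchy z₀ r g₀ g₁ (κ₁ q))
        + (ContinuousLinearMap.snd ℝ ℝ ℝ).smulRight (symmCauchy z₀ r g₀ g₁ (κ₂ q))) q := by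
  intro q hq
  have key := (hasFDerivAt_intervalIntegral_of_continuousOn hV
    (h := fun q θ => symmCauchyIntegrand z₀ r g₀ g₁ (κ q) θ)
    (h' := fun q θ => (ContinuousLinearMap.fst ℝ ℝ ℝ).smulRight
        (symmCauchyIntegrand z₀ r g₀ g₁ (κ₁ q) θ)
      + (ContinuousLinearMap.snd ℝ ℝ ℝ).smulRight
        (symmCauchyIntegrand z₀ r g₀ g₁ (κ₂ q) θ)) 0 (2 * Real.pi) ?_ ?_ ?_).1 q hq
  · refine (key.const_smul ((if z₀.im = 0 then 1 else 2) / (2 * Real.pi))).congr_fderiv ?_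
    have i1 := (continuous_symmCauchyIntegrand_right hr h0 h1 hκ₁ hq).intervalIntegrable
      (μ := MeasureTheory.volume) 0 (2 * Real.pi)
    have i2 := (continuous_symmCauchyIntegrand_right hr h0 h1 hκ₂ hq).intervalIntegrable
      (μ := MeasureTheory.volume) 0 (2 * Real.pi)
    have hL : ∀ (L : ℝ × ℝ →L[ℝ] ℝ) {f : ℝ → E},
        IntervalIntegrable f MeasureTheory.volume 0 (2 * Real.pi) →
        (IntervalIntegrable (fun θ => L.smulRight (f θ)) MeasureTheory.volume 0 (2 * Real.pi)) ∧
        ∫ θ in (0 : ℝ)..(2 * Real.pi), L.smulRight (f θ)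
          = L.smulRight (∫ θ in (0 : ℝ)..(2 * Real.pi), f θ) := fun L f hf =>
      ⟨⟨(ContinuousLinearMap.smulRightL ℝ (ℝ × ℝ) E L).integrable_comp hf.1,
        (ContinuousLinearMap.smulRightL ℝ (ℝ × ℝ) E L).integrable_comp hf.2⟩,
      ContinuousLinearMap.intervalIntegral_comp_comm
        (ContinuousLinearMap.smulRightL ℝ (ℝ × ℝ) E L) hf⟩
    rw [intervalIntegral.integral_add (hL _ i1).1 (hL _ i2).1, (hL _ i1).2, (hL _ i2).2]
    simp only [symmCauchy_eq_integral]
    ext <;> simp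
  · exact fun q hq => continuous_symmCauchyIntegrand_right hr h0 h1 hκ hq
  · intro q hq θ
    have h2 := (hd q hq _ (circleMap_mem_sphere z₀ hr θ)).mul_const (circleMap 0 r θ)
    have h3 := (Complex.reCLM.hasFDerivAt.comp q h2).smul_const (g₀ (circleMap z₀ r θ))
    have h4 := (Complex.imCLM.hasFDerivAt.comp q h2).smul_const (g₁ (circleMap z₀ r θ))
    refine (h3.sub h4).congr_fderiv ?_
    ext <;> simp [symmCauchyIntegrand] <;> ring_nf
  · have hL : ∀ L : ℝ × ℝ →L[ℝ] ℝ, Continuous fun e : E => L.smulRight e := fun L =>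
      (ContinuousLinearMap.smulRightL ℝ (ℝ × ℝ) E L).continuous
    exact ((hL _).comp_continuousOn (continuous_symmCauchyIntegrand hr h0 h1 hκ₁)).add
      ((hL _).comp_continuousOn (continuous_symmCauchyIntegrand hr h0 h1 hκ₂))

theorem isFueterSeq_symmCauchy [CompleteSpace E] {z₀ : ℂ} {r : ℝ} (hr : 0 ≤ r) {g₀ g₁ : ℂ → E}
    (h0 : ContinuousOn g₀ (sphere z₀ r)) (h1 : ContinuousOn g₁ (sphere z₀ r)) :
    IsFueterSeq (kernelDomain z₀ r)
      (fun k q => symmCauchy z₀ r g₀ g₁ (fun ζ => evenKernel k ζ q))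
      (fun k q => symmCauchy z₀ r g₀ g₁ (fun ζ => oddKernel k ζ q)) := by
  have hV := isOpen_kernelDomain z₀ r
  have he : ∀ k, ContinuousOn (fun p : (ℝ × ℝ) × ℝ => evenKernel k (circleMap z₀ r p.2) p.1)
      (kernelDomain z₀ r ×ˢ univ) := fun k => (contDiffOn_evenKernel k z₀ hr).continuousOn
  have ho : ∀ k, ContinuousOn (fun p : (ℝ × ℝ) × ℝ => oddKernel k (circleMap z₀ r p.2) p.1)
      (kernelDomain z₀ r ×ˢ univ) := fun k => (contDiffOn_oddKernel k z₀ hr).continuousOn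
  have hmul : ∀ (c : ℝ) (κ : ℂ → ℂ), symmCauchy z₀ r g₀ g₁ (fun ζ => c * κ ζ)
      = c • symmCauchy z₀ r g₀ g₁ κ := by
    intro c κ
    rw [symmCauchy_eq_integral, symmCauchy_eq_integral, smul_comm c,
      ← intervalIntegral.integral_smul c]
    refine congrArg _ (intervalIntegral.integral_congr fun θ _ => ?_)
    simp only [symmCauchyIntegrand, mul_assoc, Complex.re_ofReal_mul, Complex.im_ofReal_mul,
      smul_sub, mul_smul]
  refine ⟨hV, fun k q hq => ?_, fun k q hq => ?_⟩
  · have h2 := hasFDerivAt_symmCauchy hr h0 h1 hV (κ := fun q ζ => evenKernel k ζ q)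
      (κ₁ := fun q ζ => (2 * k + 1) * oddKernel k ζ q + 2 * q.2 * oddKernel (k + 1) ζ q)
      (κ₂ := fun q ζ => evenKernel (k + 1) ζ q) (he k) ?_ (he (k + 1))
      (fun q hq ζ hζ => hasFDerivAt_evenKernel k ζ q (hq ζ hζ)) q hq
    · refine h2.congr_fderiv ?_
      congr 2
      have i1 := (continuous_symmCauchyIntegrand_right hr h0 h1
        (κ := fun q ζ => ((2 * k + 1 : ℝ) : ℂ) * oddKernel k ζ q)
        (continuousOn_const.mul (ho k)) hq).intervalIntegrable
        (μ := MeasureTheory.volume) 0 (2 * Real.pi)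
      have i2 := (continuous_symmCauchyIntegrand_right hr h0 h1
        (κ := fun q' ζ => ((2 * q.2 : ℝ) : ℂ) * oddKernel (k + 1) ζ q')
        (continuousOn_const.mul (ho (k + 1))) hq).intervalIntegrable
        (μ := MeasureTheory.volume) 0 (2 * Real.pi)
      rw [← hmul, ← hmul]
      simp only [symmCauchy_eq_integral]
      rw [← smul_add, ← intervalIntegral.integral_add i1 i2]
      congr 1
      refine intervalIntegral.integral_congr fun θ _ => ?_
      simp only [symmCauchyIntegrand, add_mul, Complex.add_re, Complex.add_im, add_smul]
      push_cast
      simp only [add_mul, Complex.add_re, Complex.add_im, add_smul]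
      abel
    · refine ContinuousOn.add (continuousOn_const.mul (ho k)) (ContinuousOn.mul ?_ (ho (k + 1)))
      fun_prop
  · have h2 := hasFDerivAt_symmCauchy hr h0 h1 hV (κ := fun q ζ => oddKernel k ζ q)
      (κ₁ := fun q ζ => -2 * evenKernel (k + 1) ζ q)
      (κ₂ := fun q ζ => oddKernel (k + 1) ζ q) (ho k) ?_ (ho (k + 1))
      (fun q hq ζ hζ => hasFDerivAt_oddKernel k ζ q (hq ζ hζ)) q hq
    · refine h2.congr_fderiv ?_
      congr 2
      rw [← hmul]
      push_cast
      rfl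
    · exact continuousOn_const.mul (he (k + 1))

/-- No derivative of the data is lost: `κ` may be a kernel of any order, and `g₀`, `g₁` enter only
through their values on the circle. -/
theorem contDiffOn_symmCauchy_param {X : Type*} [NormedAddCommGroup X] [NormedSpace ℝ X]
    {z₀ : ℂ} {r : ℝ} (hr : 0 ≤ r) {O : Set X} (hO : IsOpen O) {g₀ g₁ : X → ℂ → E}
    {W : Set (X × ℂ)}
    (h0 : ContDiffOn ℝ 1 (Function.uncurry g₀) W) (h1 : ContDiffOn ℝ 1 (Function.uncurry g₁) W)
    (hW : ∀ x ∈ O, ∀ ζ ∈ sphere z₀ r, (x, ζ) ∈ W) {κ : ℝ × ℝ → ℂ → ℂ}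
    (hκ : ContDiffOn ℝ 1 (fun p : (ℝ × ℝ) × ℝ => κ p.1 (circleMap z₀ r p.2))
      (kernelDomain z₀ r ×ˢ univ)) :
    ContDiffOn ℝ 1 (fun p : X × (ℝ × ℝ) => symmCauchy z₀ r (g₀ p.1) (g₁ p.1) (κ p.2))
      (O ×ˢ kernelDomain z₀ r) := by
  simp only [symmCauchy_eq_integral]
  refine contDiffOn_const.smul (contDiffOn_intervalIntegral_of_contDiffOn
    (hO.prod (isOpen_kernelDomain z₀ r)) _ _ ?_)
  have hm : ∀ p ∈ (O ×ˢ kernelDomain z₀ r) ×ˢ (univ : Set ℝ),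
      (p.1.1, circleMap z₀ r p.2) ∈ W := fun p hp =>
    hW _ hp.1.1 _ (circleMap_mem_sphere z₀ hr p.2)
  have hc : ContDiff ℝ 1 fun p : (X × (ℝ × ℝ)) × ℝ => (p.1.1, circleMap z₀ r p.2) :=
    ContDiff.prodMk (by fun_prop) ((contDiff_circleMap z₀ r).comp contDiff_snd)
  have d0 := h0.comp hc.contDiffOn hm
  have d1 := h1.comp hc.contDiffOn hm
  have dκ : ContDiffOn ℝ 1 (fun p : (X × (ℝ × ℝ)) × ℝ => κ p.1.2 (circleMap z₀ r p.2))
      ((O ×ˢ kernelDomain z₀ r) ×ˢ univ) :=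
    hκ.comp (f := fun p : (X × (ℝ × ℝ)) × ℝ => (p.1.2, p.2)) (by fun_prop)
      (fun p hp => ⟨hp.1.2, hp.2⟩)
  have dW := dκ.mul ((contDiff_circleMap 0 r).comp contDiff_snd).contDiffOn
  exact ((Complex.reCLM.contDiff.comp_contDiffOn dW).smul d0).sub
    ((Complex.imCLM.contDiff.comp_contDiffOn dW).smul d1)

end FueterSeq

/-! ### Directional derivatives of `A_k + Im x · B_k` -/

section QuaternionCalculus

/-- The real part as a continuous linear map. -/
noncomputable def reQ : ℍ[ℝ] →L[ℝ] ℝ :=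
  ⟨⟨⟨fun q => q.re, fun _ _ => rfl⟩, fun _ _ => by simp⟩, Quaternion.continuous_re⟩

/-- The imaginary part as a continuous linear map. -/
noncomputable def imQ : ℍ[ℝ] →L[ℝ] ℍ[ℝ] :=
  ⟨⟨⟨fun q => q.im, fun _ _ => by ext <;> simp⟩, fun _ _ => by ext <;> simp⟩,
    Quaternion.continuous_im⟩

@[simp] theorem imQ_apply (q : ℍ[ℝ]) : imQ q = q.im := rfl

/-- The scalar product of the imaginary parts. -/
def imInner (x v : ℍ[ℝ]) : ℝ := x.imI * v.imI + x.imJ * v.imJ + x.imK * v.imK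

/-- `(Re x, |Im x|²)`. -/
def reImSq (x : ℍ[ℝ]) : ℝ × ℝ := (x.re, imInner x x)

theorem imInner_self (x : ℍ[ℝ]) : imInner x x = ‖x.im‖ ^ 2 := by
  rw [sq, ← Quaternion.normSq_eq_norm_mul_self, Quaternion.normSq_def']
  simp [imInner]; ring

theorem hasDerivAt_line (x v : ℍ[ℝ]) : HasDerivAt (fun t : ℝ => x + t • v) v 0 := by
  simpa using ((hasDerivAt_id (0 : ℝ)).smul_const v).const_add x

theorem hasDerivAt_im_line (x v : ℍ[ℝ]) : HasDerivAt (fun t : ℝ => (x + t • v).im) v.im 0 :=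
  imQ.hasFDerivAt.comp_hasDerivAt 0 (hasDerivAt_line x v)

theorem hasDerivAt_imInner_line (x v : ℍ[ℝ]) :
    HasDerivAt (fun t : ℝ => imInner (x + t • v) v) (imInner v v) 0 := by
  have h : (fun t : ℝ => imInner (x + t • v) v) = fun t => imInner x v + t * imInner v v := by
    funext t; simp [imInner]; ring
  rw [h]
  simpa using ((hasDerivAt_id (0 : ℝ)).mul_const (imInner v v)).const_add (imInner x v)

theorem hasDerivAt_reImSq_line (x v : ℍ[ℝ]) :
    HasDerivAt (fun t : ℝ => reImSq (x + t • v)) (v.re, 2 * imInner x v) 0 := by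
  refine HasDerivAt.prodMk (reQ.hasFDerivAt.comp_hasDerivAt 0 (hasDerivAt_line x v)) ?_
  have h : (fun t : ℝ => imInner (x + t • v) (x + t • v))
      = fun t => imInner x x + (t * (2 * imInner x v) + t ^ 2 * imInner v v) := by
    funext t; simp [imInner]; ring
  rw [h]
  simpa using (((hasDerivAt_id (0 : ℝ)).mul_const (2 * imInner x v)).add
    ((hasDerivAt_pow 2 (0 : ℝ)).mul_const (imInner v v))).const_add (imInner x x)

theorem contDiff_imQ {r : WithTop ℕ∞} : ContDiff ℝ r fun x : ℍ[ℝ] => x.im := imQ.contDiff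

theorem contDiff_reImSq {r : WithTop ℕ∞} : ContDiff ℝ r reImSq := by
  refine reQ.contDiff.prodMk ?_
  simp only [imInner_self]
  exact contDiff_imQ.norm_sq ℝ

variable {V : Set (ℝ × ℝ)} {A B : ℕ → ℝ × ℝ → ℍ[ℝ]}

/-- The slice function `A k + Im x · B k` of one variable. -/
noncomputable def sliceSeq (A B : ℕ → ℝ × ℝ → ℍ[ℝ]) (k : ℕ) (x : ℍ[ℝ]) : ℍ[ℝ] :=
  A k (reImSq x) + x.im * B k (reImSq x)

theorem IsFueterSeq.contDiffAt_sliceSeq (h : IsFueterSeq V A B) (r k : ℕ) {x : ℍ[ℝ]}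
    (hx : reImSq x ∈ V) : ContDiffAt ℝ r (sliceSeq A B k) x :=
  ((h.contDiffAt r k _ hx).1.comp x contDiff_reImSq.contDiffAt).add
    (contDiff_imQ.contDiffAt.mul ((h.contDiffAt r k _ hx).2.comp x contDiff_reImSq.contDiffAt))

theorem IsFueterSeq.hasLineDerivAt_odd (h : IsFueterSeq V A B) (k : ℕ) {x : ℍ[ℝ]}
    (hx : reImSq x ∈ V) (v : ℍ[ℝ]) :
    HasLineDerivAt ℝ (fun x => B k (reImSq x))
      ((-2 * v.re) • A (k + 1) (reImSq x) + (2 * imInner x v) • B (k + 1) (reImSq x)) x v := by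
  have h1 : HasFDerivAt (B k) _ (reImSq (x + (0 : ℝ) • v)) := h.odd k _ (by simpa using hx)
  refine (h1.comp_hasDerivAt 0 (hasDerivAt_reImSq_line x v)).congr_deriv ?_
  simp [smul_smul, mul_comm]

theorem IsFueterSeq.hasLineDerivAt_even (h : IsFueterSeq V A B) (k : ℕ) {x : ℍ[ℝ]}
    (hx : reImSq x ∈ V) (v : ℍ[ℝ]) :
    HasLineDerivAt ℝ (fun x => A k (reImSq x))
      (v.re • ((2 * k + 1 : ℝ) • B k (reImSq x) + (2 * imInner x x) • B (k + 1) (reImSq x))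
        + (2 * imInner x v) • A (k + 1) (reImSq x)) x v := by
  have h1 : HasFDerivAt (A k) _ (reImSq (x + (0 : ℝ) • v)) := h.even k _ (by simpa using hx)
  refine (h1.comp_hasDerivAt 0 (hasDerivAt_reImSq_line x v)).congr_deriv ?_
  simp [reImSq]

/-- The value of the directional derivative of `sliceSeq A B k`. -/
noncomputable def sliceSeqDeriv (A B : ℕ → ℝ × ℝ → ℍ[ℝ]) (k : ℕ) (v x : ℍ[ℝ]) : ℍ[ℝ] :=
  v.re • ((2 * k + 1 : ℝ) • B k (reImSq x) - (2 : ℝ) • (x.im * sliceSeq A B (k + 1) x))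
    + (2 * imInner x v) • sliceSeq A B (k + 1) x + v.im * B k (reImSq x)

/-- Since `(Im x)² = -s`, the terms in `A_{k+1}` and `B_{k+1}` recombine into `sliceSeq A B (k +
1)`, so this result can be reused for the second derivative. -/
theorem IsFueterSeq.hasLineDerivAt_sliceSeq (h : IsFueterSeq V A B) (k : ℕ) {x : ℍ[ℝ]}
    (hx : reImSq x ∈ V) (v : ℍ[ℝ]) :
    HasLineDerivAt ℝ (sliceSeq A B k) (sliceSeqDeriv A B k v x) x v := by
  have h1 := HasDerivAt.add (h.hasLineDerivAt_even k hx v)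
    ((hasDerivAt_im_line x v).mul (h.hasLineDerivAt_odd k hx v))
  refine HasDerivAt.congr_deriv h1 ?_
  ext <;> simp [sliceSeqDeriv, sliceSeq, imInner] <;> ring

/-- The value of the second directional derivative of `sliceSeq A B k`. -/
noncomputable def sliceSeqDerivTwo (A B : ℕ → ℝ × ℝ → ℍ[ℝ]) (k : ℕ) (v x : ℍ[ℝ]) : ℍ[ℝ] :=
  v.re • ((2 * k + 1 : ℝ) • ((-2 * v.re) • A (k + 1) (reImSq x)
        + (2 * imInner x v) • B (k + 1) (reImSq x))
      - (2 : ℝ) • (v.im * sliceSeq A B (k + 1) x + x.im * sliceSeqDeriv A B (k + 1) v x))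
    + ((2 * imInner x v) • sliceSeqDeriv A B (k + 1) v x
      + (2 * imInner v v) • sliceSeq A B (k + 1) x)
    + v.im * ((-2 * v.re) • A (k + 1) (reImSq x) + (2 * imInner x v) • B (k + 1) (reImSq x))

theorem IsFueterSeq.hasLineDerivAt_sliceSeqDeriv (h : IsFueterSeq V A B) (k : ℕ) {x : ℍ[ℝ]}
    (hx : reImSq x ∈ V) (v : ℍ[ℝ]) :
    HasLineDerivAt ℝ (sliceSeqDeriv A B k v) (sliceSeqDerivTwo A B k v x) x v := by
  have hb := h.hasLineDerivAt_odd k hx v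
  have hn := h.hasLineDerivAt_sliceSeq (k + 1) hx v
  have h1 := HasDerivAt.add (HasDerivAt.add (((hb.const_smul (2 * k + 1 : ℝ)).sub
    (((hasDerivAt_im_line x v).mul hn).const_smul (2 : ℝ))).const_smul v.re)
    (((hasDerivAt_imInner_line x v).const_mul 2).smul hn)) (hb.const_mul v.im)
  refine HasDerivAt.congr_deriv h1 ?_
  simp [sliceSeqDerivTwo]

end QuaternionCalculus

/-! ### Fueter's computation: the Laplacian and its Cauchy–Riemann–Fueter derivative -/

section Laplacian

@[simp] theorem qi_re : qi.re = 0 := rfl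
@[simp] theorem qi_imI : qi.imI = 1 := rfl
@[simp] theorem qi_imJ : qi.imJ = 0 := rfl
@[simp] theorem qi_imK : qi.imK = 0 := rfl
@[simp] theorem qj_re : qj.re = 0 := rfl
@[simp] theorem qj_imI : qj.imI = 0 := rfl
@[simp] theorem qj_imJ : qj.imJ = 1 := rfl
@[simp] theorem qj_imK : qj.imK = 0 := rfl
@[simp] theorem qk_re : qk.re = 0 := rfl
@[simp] theorem qk_imI : qk.imI = 0 := rfl
@[simp] theorem qk_imJ : qk.imJ = 0 := rfl
@[simp] theorem qk_imK : qk.imK = 1 := rfl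


variable {n : ℕ} {m : Fin n}

theorem update_add_smul_single (y : Fin n → ℍ[ℝ]) (x e : ℍ[ℝ]) (t : ℝ) :
    Function.update y m x + t • (Pi.single m e : Fin n → ℍ[ℝ]) = Function.update y m (x + t • e) := by
  funext k
  by_cases hk : k = m
  · subst hk; simp
  · simp [hk]

theorem pderiv_update (f : (Fin n → ℍ[ℝ]) → ℍ[ℝ]) (y : Fin n → ℍ[ℝ]) (e x : ℍ[ℝ]) :
    pderiv m e f (Function.update y m x)
      = lineDeriv ℝ (fun x => f (Function.update y m x)) x e := by
  simp only [pderiv, lineDeriv, update_add_smul_single]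

variable {V : Set (ℝ × ℝ)} {A B : ℕ → ℝ × ℝ → ℍ[ℝ]}

theorem IsFueterSeq.pderiv_eq (h : IsFueterSeq V A B) {f : (Fin n → ℍ[ℝ]) → ℍ[ℝ]}
    {y : Fin n → ℍ[ℝ]} {S : Set ℍ[ℝ]} (hS : IsOpen S) (hV : ∀ x ∈ S, reImSq x ∈ V) (k : ℕ)
    (hf : ∀ x ∈ S, f (Function.update y m x) = sliceSeq A B k x) (e : ℍ[ℝ]) :
    ∀ x ∈ S, pderiv m e f (Function.update y m x) = sliceSeqDeriv A B k e x := by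
  intro x hx
  have h1 : (fun x => f (Function.update y m x)) =ᶠ[𝓝 x] sliceSeq A B k := by
    filter_upwards [hS.mem_nhds hx] with z hz using hf z hz
  rw [pderiv_update, h1.lineDeriv_eq]
  exact (h.hasLineDerivAt_sliceSeq k (hV x hx) e).lineDeriv

/-- With `N_k = sliceSeq A B k`, the terms in `s N_2` from the real and the imaginary directions
cancel. What remains is `6 N_1 - 2 A_1 - 2 Im x · B_1 = 4 N_1`, the `6` being twice the number of
imaginary directions. -/
theorem IsFueterSeq.lapl_eq (h : IsFueterSeq V A B) {f : (Fin n → ℍ[ℝ]) → ℍ[ℝ]}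
    {y : Fin n → ℍ[ℝ]} {S : Set ℍ[ℝ]} (hS : IsOpen S) (hV : ∀ x ∈ S, reImSq x ∈ V)
    (hf : ∀ x ∈ S, f (Function.update y m x) = sliceSeq A B 0 x) :
    ∀ x ∈ S, lapl m f (Function.update y m x) = (4 : ℝ) • sliceSeq A B 1 x := by
  intro x hx
  have h2 : ∀ e, pderiv m e (pderiv m e f) (Function.update y m x)
      = sliceSeqDerivTwo A B 0 e x := by
    intro e
    have h1 : (fun x => pderiv m e f (Function.update y m x)) =ᶠ[𝓝 x] sliceSeqDeriv A B 0 e := by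
      filter_upwards [hS.mem_nhds hx] with z hz using h.pderiv_eq hS hV 0 hf e z hz
    rw [pderiv_update, h1.lineDeriv_eq]
    exact (h.hasLineDerivAt_sliceSeqDeriv 0 (hV x hx) e).lineDeriv
  simp only [lapl, h2]
  ext <;> simp [sliceSeqDerivTwo, sliceSeqDeriv, sliceSeq, imInner] <;> ring

/-- The real direction contributes `3 B_1`, the units contribute `(i² + j² + k²) B_1 = -3 B_1`, and
the terms with index `2` cancel separately. The match holds only at `k = 1`, which is why the
Laplacian is needed. -/
theorem IsFueterSeq.dbar_lapl_eq_zero (h : IsFueterSeq V A B) {f : (Fin n → ℍ[ℝ]) → ℍ[ℝ]}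
    {y : Fin n → ℍ[ℝ]} {S : Set ℍ[ℝ]} (hS : IsOpen S) (hV : ∀ x ∈ S, reImSq x ∈ V)
    (hf : ∀ x ∈ S, f (Function.update y m x) = sliceSeq A B 0 x) :
    ∀ x ∈ S, dbar m (lapl m f) (Function.update y m x) = 0 := by
  intro x hx
  have h2 : ∀ e, pderiv m e (lapl m f) (Function.update y m x)
      = (4 : ℝ) • sliceSeqDeriv A B 1 e x := by
    intro e
    have h1 : (fun x => lapl m f (Function.update y m x)) =ᶠ[𝓝 x]
        fun x => (4 : ℝ) • sliceSeq A B 1 x := by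
      filter_upwards [hS.mem_nhds hx] with z hz using h.lapl_eq hS hV hf z hz
    rw [pderiv_update, h1.lineDeriv_eq]
    exact HasLineDerivAt.lineDeriv
      (HasDerivAt.const_smul (4 : ℝ) (h.hasLineDerivAt_sliceSeq 1 (hV x hx) e))
  simp only [dbar, h2]
  ext <;> simp [sliceSeqDeriv, sliceSeq, imInner] <;> ring

end Laplacian

/-! ### Geometry of `Ω_D` and the even and odd parts along a slice -/

section Circularization

theorem re_eq_zero_of_mul_self {J : ℍ[ℝ]} (hJ : J * J = -1) : J.re = 0 ∧ ‖J‖ = 1 := by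
  have h0 := congrArg (fun q : ℍ[ℝ] => q.re) hJ
  have h1 := congrArg (fun q : ℍ[ℝ] => q.imI) hJ
  have h2 := congrArg (fun q : ℍ[ℝ] => q.imJ) hJ
  have h3 := congrArg (fun q : ℍ[ℝ] => q.imK) hJ
  simp at h0 h1 h2 h3
  constructor
  · by_contra hne
    have e1 : J.imI = 0 := by
      have : J.re * J.imI = 0 := by linarith
      exact (mul_eq_zero.1 this).resolve_left hne
    have e2 : J.imJ = 0 := by
      have : J.re * J.imJ = 0 := by linarith
      exact (mul_eq_zero.1 this).resolve_left hne
    have e3 : J.imK = 0 := by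
      have : J.re * J.imK = 0 := by linarith
      exact (mul_eq_zero.1 this).resolve_left hne
    rw [e1, e2, e3] at h0
    nlinarith [mul_self_nonneg J.re]
  · have h4 : ‖J‖ * ‖J‖ = 1 := by rw [← norm_mul, hJ, norm_neg, norm_one]
    nlinarith [norm_nonneg J]

theorem qi_mul_qi : qi * qi = -1 := by ext <;> simp

/-- The point `α + Jβ` for `ζ = α + iβ`. -/
noncomputable def slicePoint (J : ℍ[ℝ]) (ζ : ℂ) : ℍ[ℝ] := (ζ.re : ℍ[ℝ]) + J * (ζ.im : ℍ[ℝ])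

/-- The point `α + iβ`, `β ≥ 0`, with `x = α + Jβ` for some unit `J`. -/
noncomputable def upperPoint (x : ℍ[ℝ]) : ℂ := ⟨x.re, ‖x.im‖⟩

open scoped Classical in
/-- A unit `J` with `x = α + Jβ`, `β ≥ 0`. -/
noncomputable def unitOf (x : ℍ[ℝ]) : ℍ[ℝ] := if x.im = 0 then qi else ‖x.im‖⁻¹ • x.im

theorem unitOf_smul (x : ℍ[ℝ]) : ‖x.im‖ • unitOf x = x.im := by
  by_cases h : x.im = 0
  · simp [h]
  · rw [unitOf, if_neg h, smul_smul, mul_inv_cancel₀ (norm_ne_zero_iff.2 h), one_smul]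

theorem unitOf_mul_self (x : ℍ[ℝ]) : unitOf x * unitOf x = -1 := by
  by_cases h : x.im = 0
  · rw [unitOf, if_pos h, qi_mul_qi]
  · have h0 : ‖x.im‖ ≠ 0 := norm_ne_zero_iff.2 h
    have h1 : x.im * x.im = -((‖x.im‖ ^ 2 : ℝ) : ℍ[ℝ]) := by
      rw [← imInner_self]
      ext <;> simp [imInner] <;> ring
    rw [unitOf, if_neg h, smul_mul_smul_comm, h1, smul_neg, Quaternion.smul_coe]
    congr 1
    rw [← Quaternion.coe_one]
    congr 1
    field_simp

theorem slicePoint_unitOf (x : ℍ[ℝ]) : slicePoint (unitOf x) (upperPoint x) = x := by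
  have h : unitOf x * ((‖x.im‖ : ℝ) : ℍ[ℝ]) = x.im := by
    rw [Quaternion.mul_coe_eq_smul, unitOf_smul]
  rw [slicePoint, upperPoint, h, Quaternion.re_add_im]

theorem im_slicePoint {J : ℍ[ℝ]} (hJ : J * J = -1) (ζ : ℂ) :
    (slicePoint J ζ).im = ζ.im • J := by
  have := (re_eq_zero_of_mul_self hJ).1
  ext <;> simp [slicePoint, this, mul_comm]

theorem upperPoint_slicePoint {J : ℍ[ℝ]} (hJ : J * J = -1) (ζ : ℂ) :
    upperPoint (slicePoint J ζ) = ⟨ζ.re, |ζ.im|⟩ := by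
  obtain ⟨h0, h1⟩ := re_eq_zero_of_mul_self hJ
  rw [upperPoint, im_slicePoint hJ, norm_smul, h1]
  apply Complex.ext <;> simp [slicePoint, h0]

theorem upperPoint_slicePoint_cases {J : ℍ[ℝ]} (hJ : J * J = -1) (ζ : ℂ) :
    upperPoint (slicePoint J ζ) = ζ ∨ upperPoint (slicePoint J ζ) = (starRingEnd ℂ) ζ := by
  rw [upperPoint_slicePoint hJ]
  rcases abs_cases ζ.im with ⟨h, _⟩ | ⟨h, _⟩
  · exact Or.inl (Complex.ext rfl h)
  · exact Or.inr (Complex.ext rfl h)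

theorem continuous_upperPoint : Continuous upperPoint := by
  have h : upperPoint = fun x : ℍ[ℝ] => ((x.re : ℂ) + (‖x.im‖ : ℝ) * Complex.I) := by
    funext x; apply Complex.ext <;> simp [upperPoint]
  rw [h]
  have h1 := Quaternion.continuous_re
  have h2 := Quaternion.continuous_im
  fun_prop

theorem contDiff_slicePoint (J : ℍ[ℝ]) {r : WithTop ℕ∞} : ContDiff ℝ r (slicePoint J) := by
  have h : slicePoint J = fun ζ => Complex.reCLM ζ • (1 : ℍ[ℝ]) + Complex.imCLM ζ • J := by
    funext ζ
    ext <;> simp [slicePoint, mul_comm]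
  rw [h]
  exact (Complex.reCLM.contDiff.smul contDiff_const).add
    (Complex.imCLM.contDiff.smul contDiff_const)

theorem slicePoint_conj (J : ℍ[ℝ]) (ζ : ℂ) :
    slicePoint J ((starRingEnd ℂ) ζ) = slicePoint (-J) ζ := by
  simp [slicePoint]

variable {n : ℕ} {D : Set (Fin n → ℂ)}

theorem point_eq_slicePoint (z : Fin n → ℂ) (J : Fin n → ℍ[ℝ]) :
    point z J = fun h => slicePoint (J h) (z h) := rfl

theorem point_unitOf (x : Fin n → ℍ[ℝ]) :
    point (fun h => upperPoint (x h)) (fun h => unitOf (x h)) = x := by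
  funext h
  exact slicePoint_unitOf (x h)

theorem IsConjInvariant.mem_of_eq_or_conj (hD : IsConjInvariant D) {z w : Fin n → ℂ} (hz : z ∈ D)
    (hw : ∀ h, w h = z h ∨ w h = (starRingEnd ℂ) (z h)) : w ∈ D := by
  have key : ∀ s : Finset (Fin n), (fun h => if h ∈ s then w h else z h) ∈ D := by
    intro s
    induction s using Finset.induction_on with
    | empty => simpa using hz
    | insert a s ha ih =>
      rcases hw a with h | h
      · convert ih using 1
        funext k
        by_cases hk : k = a
        · subst hk; simp [ha, h]
        · simp [hk]
      · convert (hD _ a).1 ih using 1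
        funext k
        by_cases hk : k = a
        · subst hk; simp [ha, h, conjAt]
        · simp [hk, conjAt]
  simpa using key Finset.univ

/-- Two representations of a point differ by conjugations of coordinates, so the one with all `β ≥
0` decides. This exhibits `Ω_D` as a preimage under a continuous map. -/
theorem IsConjInvariant.mem_circ_iff (hD : IsConjInvariant D) {x : Fin n → ℍ[ℝ]} :
    x ∈ circ D ↔ (fun h => upperPoint (x h)) ∈ D := by
  constructor
  · rintro ⟨z, hz, J, hJ, rfl⟩
    exact hD.mem_of_eq_or_conj hz fun h => upperPoint_slicePoint_cases (hJ h) (z h)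
  · intro hx
    exact ⟨_, hx, fun h => unitOf (x h), fun h => unitOf_mul_self _, (point_unitOf x).symm⟩

theorem IsConjInvariant.isOpen_circ (hD : IsConjInvariant D) (ho : IsOpen D) :
    IsOpen (circ D) := by
  have h : circ D = (fun x : Fin n → ℍ[ℝ] => fun h => upperPoint (x h)) ⁻¹' D := by
    ext x; exact hD.mem_circ_iff
  rw [h]
  exact ho.preimage (continuous_pi fun h => continuous_upperPoint.comp (continuous_apply h))

theorem contDiff_update_param {E : Type*} [NormedAddCommGroup E] [NormedSpace ℝ E] {m : Fin n}
    {r : WithTop ℕ∞} : ContDiff ℝ r fun p : (Fin n → E) × E => Function.update p.1 m p.2 := by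
  refine contDiff_pi.2 fun k => ?_
  by_cases hk : k = m
  · subst hk; simpa using contDiff_snd
  · simp only [ne_eq, hk, not_false_eq_true, Function.update_of_ne]
    exact (contDiff_apply ℝ E k).comp contDiff_fst

/-- The domain in the variable `z_m` belonging to the values `y` of the other variables. -/
def sliceDomain (D : Set (Fin n → ℂ)) (m : Fin n) (y : Fin n → ℍ[ℝ]) : Set ℂ :=
  {ζ | Function.update y m (slicePoint qi ζ) ∈ circ D}

/-- The even part of `f` along the slices in the variable `x_m`. -/
noncomputable def sliceEven (f : (Fin n → ℍ[ℝ]) → ℍ[ℝ]) (m : Fin n) (y : Fin n → ℍ[ℝ]) (ζ : ℂ) :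
    ℍ[ℝ] :=
  (1 / 2 : ℝ) • (f (Function.update y m (slicePoint qi ζ))
    + f (Function.update y m (slicePoint (-qi) ζ)))

/-- The odd part of `f` along the slices in the variable `x_m`. -/
noncomputable def sliceOdd (f : (Fin n → ℍ[ℝ]) → ℍ[ℝ]) (m : Fin n) (y : Fin n → ℍ[ℝ]) (ζ : ℂ) :
    ℍ[ℝ] :=
  (1 / 2 : ℝ) • (-qi * (f (Function.update y m (slicePoint qi ζ))
    - f (Function.update y m (slicePoint (-qi) ζ))))

theorem IsConjInvariant.update_mem_circ_iff (hD : IsConjInvariant D) {m : Fin n}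
    {y : Fin n → ℍ[ℝ]} {x x' : ℍ[ℝ]} (h : upperPoint x = upperPoint x') :
    Function.update y m x ∈ circ D ↔ Function.update y m x' ∈ circ D := by
  rw [hD.mem_circ_iff, hD.mem_circ_iff]
  have : (fun h => upperPoint (Function.update y m x h))
      = fun h => upperPoint (Function.update y m x' h) := by
    funext k
    by_cases hk : k = m
    · subst hk; simpa using h
    · simp [hk]
  rw [this]

theorem IsConjInvariant.mem_sliceDomain_iff (hD : IsConjInvariant D) {m : Fin n}
    {y : Fin n → ℍ[ℝ]} {J : ℍ[ℝ]} (hJ : J * J = -1) {ζ : ℂ} :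
    ζ ∈ sliceDomain D m y ↔ Function.update y m (slicePoint J ζ) ∈ circ D :=
  hD.update_mem_circ_iff (by rw [upperPoint_slicePoint hJ, upperPoint_slicePoint qi_mul_qi])

theorem IsConjInvariant.upperPoint_mem_sliceDomain_iff (hD : IsConjInvariant D) {m : Fin n}
    {y : Fin n → ℍ[ℝ]} {x : ℍ[ℝ]} :
    upperPoint x ∈ sliceDomain D m y ↔ Function.update y m x ∈ circ D := by
  rw [hD.mem_sliceDomain_iff (unitOf_mul_self x), slicePoint_unitOf]

theorem IsConjInvariant.isOpen_sliceDomain_graph (hD : IsConjInvariant D) (ho : IsOpen D)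
    (m : Fin n) : IsOpen {p : (Fin n → ℍ[ℝ]) × ℂ | p.2 ∈ sliceDomain D m p.1} := by
  have hc : Continuous fun p : (Fin n → ℍ[ℝ]) × ℂ => Function.update p.1 m (slicePoint qi p.2) :=
    (contDiff_update_param (r := 0)).continuous.comp
      (continuous_fst.prodMk ((contDiff_slicePoint (r := 0) qi).continuous.comp continuous_snd))
  exact (hD.isOpen_circ ho).preimage hc

theorem neg_qi_mul_neg_qi : (-qi) * (-qi) = -1 := by rw [neg_mul_neg, qi_mul_qi]

/-- The hypothesis supplies an unrelated stem function for each `y`. Recovering its components from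
the values of `f` at the units `±i` gives functions whose dependence on `y` is as regular as `f`
itself. -/
theorem IsSliceRegularIn.isHolPair {m : Fin n} (ho : IsOpen D) (hD : IsConjInvariant D)
    {f : (Fin n → ℍ[ℝ]) → ℍ[ℝ]} (hf : IsSliceRegularIn D m f) {y : Fin n → ℍ[ℝ]}
    (hy : y ∈ circ D) :
    IsHolPair (sliceDomain D m y) (sliceEven f m y) (sliceOdd f m y) ∧
    ∀ ζ ∈ sliceDomain D m y, ∀ J : ℍ[ℝ], J * J = -1 →
      f (Function.update y m (slicePoint J ζ)) = sliceEven f m y ζ + J * sliceOdd f m y ζ := by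
  obtain ⟨G, ⟨-, hG⟩, hG1, hG2, hG3⟩ := hf.2 y hy
  have hUo : IsOpen (sliceDomain D m y) :=
    (hD.isOpen_sliceDomain_graph ho m).preimage (Continuous.prodMk_right y)
  have hmem : ∀ ζ ∈ sliceDomain D m y, (fun _ => ζ : Fin 1 → ℂ) ∈ fiber D m y := by
    intro ζ hζ J hJ
    exact (hD.mem_sliceDomain_iff (hJ 0)).1 hζ
  have hmem' : ∀ w ∈ fiber D m y, w 0 ∈ sliceDomain D m y := by
    intro w hw
    exact hw (fun _ => qi) (fun _ => qi_mul_qi)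
  have hfo : IsOpen (fiber D m y) := by
    have : fiber D m y = (fun w : Fin 1 → ℂ => w 0) ⁻¹' sliceDomain D m y := by
      ext w
      refine ⟨hmem' w, fun hw => ?_⟩
      have := hmem (w 0) hw
      have e : (fun _ => w 0 : Fin 1 → ℂ) = w := by funext k; rw [Subsingleton.elim k 0]
      rwa [e] at this
    rw [this]
    exact hUo.preimage (continuous_apply 0)
  have hconj : ∀ ζ ∈ sliceDomain D m y, (starRingEnd ℂ) ζ ∈ sliceDomain D m y := by
    intro ζ hζ
    rw [sliceDomain, Set.mem_ofPred_eq, slicePoint_conj]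
    exact (hD.mem_sliceDomain_iff neg_qi_mul_neg_qi).1 hζ
  set u : ℂ → ℍ[ℝ] := fun ζ => G (fun _ => ζ) ∅ with hu
  set v : ℂ → ℍ[ℝ] := fun ζ => G (fun _ => ζ) {0} with hv
  have hfu : ∀ ζ ∈ sliceDomain D m y, ∀ J : ℍ[ℝ], J * J = -1 →
      f (Function.update y m (slicePoint J ζ)) = u ζ + J * v ζ := by
    intro ζ hζ J hJ
    have h1 := hG3 _ (hmem ζ hζ) (fun _ => J) (fun _ => hJ)
    have h2 : (Finset.univ : Finset (Finset (Fin 1))) = {∅, {0}} := by decide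
    rw [h2, Finset.sum_pair (by decide)] at h1
    simpa [orderedProd, point_eq_slicePoint] using h1
  have heu : EqOn (sliceEven f m y) u (sliceDomain D m y) := by
    intro ζ hζ
    rw [sliceEven, hfu ζ hζ qi qi_mul_qi, hfu ζ hζ (-qi) neg_qi_mul_neg_qi]
    ext <;> simp <;> ring
  have hev : EqOn (sliceOdd f m y) v (sliceDomain D m y) := by
    intro ζ hζ
    rw [sliceOdd, hfu ζ hζ qi qi_mul_qi, hfu ζ hζ (-qi) neg_qi_mul_neg_qi]
    have : u ζ + qi * v ζ - (u ζ + -qi * v ζ) = (2 : ℝ) • (qi * v ζ) := by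
      rw [two_smul]; noncomm_ring
    rw [this, mul_smul_comm, smul_smul, neg_mul, ← mul_assoc, qi_mul_qi]
    norm_num
  have hdiag : ContDiff ℝ 1 fun ζ : ℂ => (fun _ => ζ : Fin 1 → ℂ) :=
    contDiff_pi.2 fun _ => contDiff_id
  have hGc : ContDiffOn ℝ 1 (fun ζ : ℂ => G (fun _ => ζ)) (sliceDomain D m y) :=
    hG1.comp hdiag.contDiffOn hmem
  have huc : ContDiffOn ℝ 1 u (sliceDomain D m y) := contDiffOn_pi.1 hGc ∅
  have hvc : ContDiffOn ℝ 1 v (sliceDomain D m y) := contDiffOn_pi.1 hGc {0}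
  have hline : ∀ ζ ∈ sliceDomain D m y, ∀ (K : Finset (Fin 1)) (w : ℂ),
      lineDeriv ℝ G (fun _ => ζ) (Pi.single 0 w) K
        = fderiv ℝ (fun ζ : ℂ => G (fun _ => ζ) K) ζ w := by
    intro ζ hζ K w
    have hGd : DifferentiableAt ℝ G (fun _ => ζ) :=
      (hG1.contDiffAt (hfo.mem_nhds (hmem ζ hζ))).differentiableAt one_ne_zero
    have hs : (Pi.single 0 w : Fin 1 → ℂ) = fun _ => w := by
      funext k; rw [Subsingleton.elim k 0]; simp
    rw [hGd.lineDeriv_eq_fderiv, hs]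
    have hL : HasFDerivAt (fun ζ : ℂ => (fun _ => ζ : Fin 1 → ℂ))
        (ContinuousLinearMap.pi fun _ => ContinuousLinearMap.id ℝ ℂ) ζ :=
      hasFDerivAt_pi.2 fun _ => hasFDerivAt_id ζ
    have h3 : HasFDerivAt (fun ζ : ℂ => G (fun _ => ζ)) _ ζ :=
      HasFDerivAt.comp (g := G) ζ hGd.hasFDerivAt hL
    have h4 := hasFDerivAt_pi'.1 h3 K
    rw [h4.fderiv]
    rfl
  have hcr : ∀ ζ ∈ sliceDomain D m y, fderiv ℝ u ζ 1 = fderiv ℝ v ζ Complex.I ∧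
      fderiv ℝ u ζ Complex.I = -fderiv ℝ v ζ 1 := by
    intro ζ hζ
    have h1 := hG2 0 _ (hmem ζ hζ)
    rw [stemDbar, smul_eq_zero] at h1
    have h2 := h1.resolve_left (by norm_num)
    have h3 := congrFun h2 ∅
    have h4 := congrFun h2 {0}
    have s1 : symmDiff (∅ : Finset (Fin 1)) {0} = {0} := by decide
    have s2 : symmDiff ({0} : Finset (Fin 1)) {0} = ∅ := by decide
    simp only [Pi.add_apply, cplxStr, s1, s2, hline ζ hζ, Pi.zero_apply] at h3 h4
    simp only [Finset.inter_self, Finset.card_singleton, pow_one, neg_mul, one_mul,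
      Finset.empty_inter, Finset.card_empty, pow_zero] at h3 h4
    exact ⟨by rw [← sub_eq_zero, sub_eq_add_neg]; exact h3,
      by rw [eq_neg_iff_add_eq_zero, add_comm]; exact h4⟩
  have hfe : ∀ ζ ∈ sliceDomain D m y, fderiv ℝ (sliceEven f m y) ζ = fderiv ℝ u ζ :=
    fun ζ hζ => (heu.eventuallyEq_of_mem (hUo.mem_nhds hζ)).fderiv_eq
  have hfv : ∀ ζ ∈ sliceDomain D m y, fderiv ℝ (sliceOdd f m y) ζ = fderiv ℝ v ζ :=
    fun ζ hζ => (hev.eventuallyEq_of_mem (hUo.mem_nhds hζ)).fderiv_eq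
  refine ⟨⟨hUo, huc.congr heu, hvc.congr hev, fun ζ hζ => ?_, fun ζ hζ => ?_, hconj,
    fun ζ _ => ?_, fun ζ _ => ?_⟩, fun ζ hζ J hJ => ?_⟩
  · rw [hfe ζ hζ, hfv ζ hζ]; exact (hcr ζ hζ).1
  · rw [hfe ζ hζ, hfv ζ hζ]; exact (hcr ζ hζ).2
  · simp only [sliceEven, slicePoint_conj, neg_neg, add_comm]
  · simp only [sliceOdd, slicePoint_conj, neg_neg]
    rw [← smul_neg, ← mul_neg, neg_sub]
  · rw [hfu ζ hζ J hJ, heu hζ, hev hζ]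

end Circularization

/-! ### Cauchy representation of `f` in `x_m` and regularity of the Laplacian -/

section Representation

open Metric

variable {n : ℕ} {m : Fin n} {D : Set (Fin n → ℂ)} {f : (Fin n → ℍ[ℝ]) → ℍ[ℝ]}

/-- The `k`-th term of the even part of the Cauchy representation of `f` in the variable `x_m`. -/
noncomputable def cauchyEven (f : (Fin n → ℍ[ℝ]) → ℍ[ℝ]) (m : Fin n) (z₀ : ℂ) (r : ℝ)
    (y : Fin n → ℍ[ℝ]) (k : ℕ) (q : ℝ × ℝ) : ℍ[ℝ] :=
  symmCauchy z₀ r (sliceEven f m y) (sliceOdd f m y) (fun ζ => evenKernel k ζ q)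

/-- The `k`-th term of the odd part of the Cauchy representation of `f` in the variable `x_m`. -/
noncomputable def cauchyOdd (f : (Fin n → ℍ[ℝ]) → ℍ[ℝ]) (m : Fin n) (z₀ : ℂ) (r : ℝ)
    (y : Fin n → ℍ[ℝ]) (k : ℕ) (q : ℝ × ℝ) : ℍ[ℝ] :=
  symmCauchy z₀ r (sliceEven f m y) (sliceOdd f m y) (fun ζ => oddKernel k ζ q)

/-- `C(z₀, r)` and its interior are admissible for the Cauchy representation at `y`. -/
structure IsAdmissible (D : Set (Fin n → ℂ)) (m : Fin n) (y : Fin n → ℍ[ℝ]) (z₀ : ℂ) (r : ℝ) :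
    Prop where
  pos : 0 < r
  lt_im : z₀.im ≠ 0 → r < |z₀.im|
  subset : closedBall z₀ r ⊆ sliceDomain D m y

theorem reImSq_eq_upperPoint (x : ℍ[ℝ]) :
    reImSq x = ((upperPoint x).re, (upperPoint x).im ^ 2) := by
  simp [reImSq, upperPoint, imInner_self]

theorem exists_isAdmissible (ho : IsOpen D) (hD : IsConjInvariant D) {y : Fin n → ℍ[ℝ]} {z₀ : ℂ}
    (hz : z₀ ∈ sliceDomain D m y) : ∃ r, IsAdmissible D m y z₀ r := by
  have hUo : IsOpen (sliceDomain D m y) :=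
    (hD.isOpen_sliceDomain_graph ho m).preimage (Continuous.prodMk_right y)
  obtain ⟨ε, hε, hb⟩ := nhds_basis_closedBall.mem_iff.1 (hUo.mem_nhds hz)
  by_cases h : z₀.im = 0
  · exact ⟨ε, hε, fun h' => absurd h h', hb⟩
  · have h' : 0 < |z₀.im| := abs_pos.2 h
    refine ⟨min ε (|z₀.im| / 2), lt_min hε (half_pos h'), fun _ => ?_,
      (closedBall_subset_closedBall (min_le_left _ _)).trans hb⟩
    exact (min_le_right _ _).trans_lt (half_lt_self h')

/-- Cauchy's formula at `upperPoint x` yields `g₀ = A` and `g₁ = |Im x| B`; multiplying the latter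
by the unit of `x` turns `|Im x|` into `Im x`. -/
theorem IsSliceRegularIn.representation (ho : IsOpen D) (hD : IsConjInvariant D)
    (hf : IsSliceRegularIn D m f) {y : Fin n → ℍ[ℝ]} (hy : y ∈ circ D) {z₀ : ℂ} {r : ℝ}
    (ha : IsAdmissible D m y z₀ r) :
    IsFueterSeq (kernelDomain z₀ r) (cauchyEven f m z₀ r y) (cauchyOdd f m z₀ r y) ∧
    IsOpen (upperPoint ⁻¹' ball z₀ r) ∧
    (∀ x ∈ upperPoint ⁻¹' ball z₀ r, reImSq x ∈ kernelDomain z₀ r) ∧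
    ∀ x ∈ upperPoint ⁻¹' ball z₀ r, f (Function.update y m x)
      = sliceSeq (cauchyEven f m z₀ r y) (cauchyOdd f m z₀ r y) 0 x := by
  obtain ⟨hp, hrep⟩ := hf.isHolPair ho hD hy
  have hs : sphere z₀ r ⊆ sliceDomain D m y := sphere_subset_closedBall.trans ha.subset
  refine ⟨isFueterSeq_symmCauchy ha.pos.le (hp.even.continuousOn.mono hs)
    (hp.odd.continuousOn.mono hs), isOpen_ball.preimage continuous_upperPoint, ?_, ?_⟩
  · intro x hx
    rw [reImSq_eq_upperPoint]
    exact (mem_kernelDomain ha.lt_im hx).1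
  · intro x hx
    obtain ⟨h0, h1⟩ := hp.symmCauchy_eq ha.subset ha.lt_im hx
    have h2 := hrep _ (ha.subset (ball_subset_closedBall hx)) _ (unitOf_mul_self x)
    rw [slicePoint_unitOf] at h2
    rw [h2, sliceSeq, reImSq_eq_upperPoint, ← h0, ← h1, mul_smul_comm, ← smul_mul_assoc]
    simp only [upperPoint, unitOf_smul]
    rfl

theorem IsSliceRegularIn.exists_representation (ho : IsOpen D) (hD : IsConjInvariant D)
    (hf : IsSliceRegularIn D m f) {y : Fin n → ℍ[ℝ]} (hy : y ∈ circ D) {x : ℍ[ℝ]}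
    (hx : Function.update y m x ∈ circ D) :
    ∃ (V : Set (ℝ × ℝ)) (A B : ℕ → ℝ × ℝ → ℍ[ℝ]) (S : Set ℍ[ℝ]), IsFueterSeq V A B ∧ IsOpen S ∧
      x ∈ S ∧ (∀ x ∈ S, reImSq x ∈ V) ∧
      ∀ x ∈ S, f (Function.update y m x) = sliceSeq A B 0 x := by
  obtain ⟨r, ha⟩ := exists_isAdmissible ho hD (hD.upperPoint_mem_sliceDomain_iff.2 hx)
  obtain ⟨h1, h2, h3, h4⟩ := hf.representation ho hD hy ha
  exact ⟨_, _, _, _, h1, h2, mem_ball_self ha.pos, h3, h4⟩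

theorem IsSliceRegularIn.isCIn_two (ho : IsOpen D) (hD : IsConjInvariant D)
    (hf : IsSliceRegularIn D m f) : IsCIn 2 D m f := by
  intro y hy x hx
  obtain ⟨V, A, B, S, h, hS, hxS, hV, hrep⟩ := hf.exists_representation ho hD hy hx
  refine ((h.contDiffAt_sliceSeq 2 0 (hV x hxS)).congr_of_eventuallyEq ?_).contDiffWithinAt
  filter_upwards [hS.mem_nhds hxS] with z hz using hrep z hz

theorem IsSliceRegularIn.isCIn_one_lapl (ho : IsOpen D) (hD : IsConjInvariant D)
    (hf : IsSliceRegularIn D m f) : IsCIn 1 D m (lapl m f) := by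
  intro y hy x hx
  obtain ⟨V, A, B, S, h, hS, hxS, hV, hrep⟩ := hf.exists_representation ho hD hy hx
  refine (((h.contDiffAt_sliceSeq 1 1 (hV x hxS)).const_smul (4 : ℝ)).congr_of_eventuallyEq
    ?_).contDiffWithinAt
  filter_upwards [hS.mem_nhds hxS] with z hz using h.lapl_eq hS hV hrep z hz

theorem IsSliceRegularIn.dbar_lapl_eq_zero (ho : IsOpen D) (hD : IsConjInvariant D)
    (hf : IsSliceRegularIn D m f) : ∀ x ∈ circ D, dbar m (lapl m f) x = 0 := by
  intro x hx
  have hx' : Function.update x m (x m) = x := Function.update_eq_self m x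
  obtain ⟨V, A, B, S, h, hS, hxS, hV, hrep⟩ :=
    hf.exists_representation ho hD hx (x := x m) (by rwa [hx'])
  have := h.dbar_lapl_eq_zero hS hV hrep (x m) hxS
  rwa [hx'] at this

/-- Near `x₀` the Laplacian is four times a Cauchy integral with kernels of index `1`, whose data
are values of the `C¹` function `f` depending on all variables jointly. -/
theorem IsSliceRegularIn.contDiffOn_lapl (ho : IsOpen D) (hD : IsConjInvariant D)
    (hf : IsSliceRegularIn D m f) (hf1 : ContDiffOn ℝ 1 f (circ D)) :
    ContDiffOn ℝ 1 (lapl m f) (circ D) := by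
  intro x₀ hx₀
  refine ContDiffAt.contDiffWithinAt ?_
  set W : Set ((Fin n → ℍ[ℝ]) × ℂ) := {p | p.2 ∈ sliceDomain D m p.1} with hW
  have hWo : IsOpen W := hD.isOpen_sliceDomain_graph ho m
  have hz₀ : upperPoint (x₀ m) ∈ sliceDomain D m x₀ := by
    rw [hD.upperPoint_mem_sliceDomain_iff, Function.update_eq_self]
    exact hx₀
  set z₀ := upperPoint (x₀ m)
  obtain ⟨r, ha⟩ := exists_isAdmissible ho hD hz₀
  -- By compactness one and the same circle serves all `y` near `x₀`.
  have hev : ∀ᶠ y in 𝓝 x₀, y ∈ circ D ∧ ∀ ζ ∈ closedBall z₀ r, ζ ∈ sliceDomain D m y := by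
    refine ((hD.isOpen_circ ho).eventually_mem hx₀).and ?_
    refine (isCompact_closedBall z₀ r).eventually_forall_of_forall_eventually fun ζ hζ => ?_
    exact hWo.mem_nhds (ha.subset hζ)
  obtain ⟨O, hO, hOo, hxO⟩ := _root_.eventually_nhds_iff.1 hev
  have hs : ∀ I : ℍ[ℝ], I * I = -1 → ContDiffOn ℝ 1
      (fun p : (Fin n → ℍ[ℝ]) × ℂ => f (Function.update p.1 m (slicePoint I p.2))) W := by
    intro I hI
    have hc : ContDiff ℝ 1 fun p : (Fin n → ℍ[ℝ]) × ℂ =>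
        Function.update p.1 m (slicePoint I p.2) :=
      contDiff_update_param.comp (contDiff_fst.prodMk ((contDiff_slicePoint I).comp contDiff_snd))
    exact hf1.comp hc.contDiffOn fun p hp => (hD.mem_sliceDomain_iff hI).1 hp
  have he : ContDiffOn ℝ 1 (Function.uncurry (sliceEven f m)) W :=
    ((hs qi qi_mul_qi).add (hs (-qi) neg_qi_mul_neg_qi)).const_smul (1 / 2 : ℝ)
  have hd : ContDiffOn ℝ 1 (Function.uncurry (sliceOdd f m)) W :=
    (contDiffOn_const.mul
      ((hs qi qi_mul_qi).sub (hs (-qi) neg_qi_mul_neg_qi))).const_smul (1 / 2 : ℝ)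
  have hsph : ∀ y ∈ O, ∀ ζ ∈ sphere z₀ r, (y, ζ) ∈ W := fun y hy ζ hζ =>
    (hO y hy).2 ζ (sphere_subset_closedBall hζ)
  have hsq : ContDiff ℝ 1 fun y : Fin n → ℍ[ℝ] => (y, reImSq (y m)) :=
    contDiff_id.prodMk (contDiff_reImSq.comp (contDiff_apply ℝ ℍ[ℝ] m))
  have hmem : (x₀, reImSq (x₀ m)) ∈ O ×ˢ kernelDomain z₀ r := by
    refine ⟨hxO, ?_⟩
    rw [reImSq_eq_upperPoint]
    exact (mem_kernelDomain ha.lt_im (mem_ball_self ha.pos)).1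
  have hnhds : O ×ˢ kernelDomain z₀ r ∈ 𝓝 (x₀, reImSq (x₀ m)) :=
    (hOo.prod (isOpen_kernelDomain z₀ r)).mem_nhds hmem
  have ce : ContDiffAt ℝ 1 (fun y => cauchyEven f m z₀ r y 1 (reImSq (y m))) x₀ :=
    ((contDiffOn_symmCauchy_param ha.pos.le hOo he hd hsph
      (κ := fun q ζ => evenKernel 1 ζ q) (contDiffOn_evenKernel 1 z₀ ha.pos.le)).contDiffAt
      hnhds).comp (f := fun y : Fin n → ℍ[ℝ] => (y, reImSq (y m))) x₀ hsq.contDiffAt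
  have co : ContDiffAt ℝ 1 (fun y => cauchyOdd f m z₀ r y 1 (reImSq (y m))) x₀ :=
    ((contDiffOn_symmCauchy_param ha.pos.le hOo he hd hsph
      (κ := fun q ζ => oddKernel 1 ζ q) (contDiffOn_oddKernel 1 z₀ ha.pos.le)).contDiffAt
      hnhds).comp (f := fun y : Fin n → ℍ[ℝ] => (y, reImSq (y m))) x₀ hsq.contDiffAt
  have hN : ContDiffAt ℝ 1 (fun y => (4 : ℝ) • sliceSeq (cauchyEven f m z₀ r y)
      (cauchyOdd f m z₀ r y) 1 (y m)) x₀ :=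
    (ce.add (((contDiff_imQ.comp (contDiff_apply ℝ ℍ[ℝ] m)).contDiffAt).mul co)).const_smul
      (4 : ℝ)
  refine hN.congr_of_eventuallyEq ?_
  have hball : ∀ᶠ y in 𝓝 x₀, upperPoint (y m) ∈ ball z₀ r :=
    (continuous_upperPoint.comp (continuous_apply m)).continuousAt.eventually_mem
      (ball_mem_nhds z₀ ha.pos)
  filter_upwards [hOo.mem_nhds hxO, hball] with y hy hyb
  obtain ⟨h1, h2, h3, h4⟩ := hf.representation ho hD (hO y hy).1
    ⟨ha.pos, ha.lt_im, fun ζ hζ => (hO y hy).2 ζ hζ⟩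
  have := h1.lapl_eq h2 h3 h4 (y m) hyb
  rwa [Function.update_eq_self] at this

end Representation

/-! ### Uniqueness of stem functions and the closed space of functions `J ↦ ∑ J_K c_K` -/

section SliceSpan

variable {n : ℕ}

theorem list_prod_update_neg (h : Fin n) (J : Fin n → ℍ[ℝ]) (l : List (Fin n)) (hl : l.Nodup) :
    (l.map (Function.update J h (-J h))).prod
      = (if h ∈ l then (-1 : ℝ) else 1) • (l.map J).prod := by
  induction l with
  | nil => simp
  | cons a l ih =>
    rw [List.nodup_cons] at hl
    rw [List.map_cons, List.prod_cons, List.map_cons, List.prod_cons, ih hl.2]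
    by_cases ha : a = h
    · subst ha
      simp [hl.1]
    · have ha' : ¬ h = a := fun e => ha e.symm
      simp [ha, ha']

theorem orderedProd_update_neg (h : Fin n) (K : Finset (Fin n)) (J : Fin n → ℍ[ℝ]) :
    orderedProd K (Function.update J h (-J h))
      = (if h ∈ K then (-1 : ℝ) else 1) • orderedProd K J := by
  rw [orderedProd, list_prod_update_neg h J _ (Finset.sort_nodup _ _)]
  simp [orderedProd]

theorem neg_one_pow_card_inter (h : Fin n) (K : Finset (Fin n)) (q : ℍ[ℝ]) :
    (-1) ^ (K ∩ {h}).card * q = (if h ∈ K then (-1 : ℝ) else 1) • q := by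
  by_cases hk : h ∈ K
  · simp [hk]
  · simp [hk]

theorem IsUnits.update {J : Fin n → ℍ[ℝ]} (hJ : IsUnits J) (h : Fin n) {I : ℍ[ℝ]}
    (hI : I * I = -1) : IsUnits (Function.update J h I) := by
  intro k
  by_cases hk : k = h
  · subst hk; simpa using hI
  · simpa [hk] using hJ k

theorem IsUnits.update_neg {J : Fin n → ℍ[ℝ]} (hJ : IsUnits J) (h : Fin n) :
    IsUnits (Function.update J h (-J h)) :=
  hJ.update h (by rw [neg_mul_neg]; exact hJ h)

theorem sum_orderedProd_update_neg (c : Finset (Fin n) → ℍ[ℝ]) (h : Fin n) (J : Fin n → ℍ[ℝ]) :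
    ∑ K, orderedProd K (Function.update J h (-J h)) * c K
      = ∑ K, orderedProd K J * ((if h ∈ K then (-1 : ℝ) else 1) • c K) := by
  refine Finset.sum_congr rfl fun K _ => ?_
  rw [orderedProd_update_neg, smul_mul_assoc, mul_smul_comm]

/-- Replacing `J_h` by `-J_h` changes the sign of exactly the terms with `h ∈ K`; half the sum or
difference isolates either kind. -/
theorem sum_orderedProd_restrict {c : Finset (Fin n) → ℍ[ℝ]}
    (hc : ∀ J, IsUnits J → ∑ K, orderedProd K J * c K = 0) (h : Fin n) (b : Bool) :
    ∀ J, IsUnits J → ∑ K, orderedProd K J * (if decide (h ∈ K) = b then c K else 0) = 0 := by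
  intro J hJ
  have h1 := hc J hJ
  have h2 := hc _ (hJ.update_neg h)
  rw [sum_orderedProd_update_neg] at h2
  have h3 : ∑ K, orderedProd K J * (if decide (h ∈ K) = b then c K else 0)
      = (1 / 2 : ℝ) • (∑ K, orderedProd K J * c K + (if b then (-1 : ℝ) else 1) •
        ∑ K, orderedProd K J * ((if h ∈ K then (-1 : ℝ) else 1) • c K)) := by
    rw [Finset.smul_sum, ← Finset.sum_add_distrib, Finset.smul_sum]
    refine Finset.sum_congr rfl fun K _ => ?_
    cases b <;> by_cases hk : h ∈ K <;> simp [hk] <;> module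
  rw [h3, h1, h2, smul_zero, add_zero, smul_zero]

theorem orderedProd_ne_zero (K : Finset (Fin n)) {J : Fin n → ℍ[ℝ]} (hJ : IsUnits J) :
    orderedProd K J ≠ 0 := by
  refine List.prod_ne_zero fun h => ?_
  obtain ⟨k, -, hk⟩ := List.mem_map.1 h
  have := hJ k
  rw [hk] at this
  simp at this

/-- Sorting by membership of every index in turn leaves the single term `K₀`, and `J_{K₀}` is
invertible. -/
theorem eq_zero_of_sum_orderedProd {c : Finset (Fin n) → ℍ[ℝ]}
    (hc : ∀ J, IsUnits J → ∑ K, orderedProd K J * c K = 0) : c = 0 := by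
  funext K₀
  have key : ∀ S : Finset (Fin n), ∀ J, IsUnits J → ∑ K, orderedProd K J *
      (if ∀ h ∈ S, decide (h ∈ K) = decide (h ∈ K₀) then c K else 0) = 0 := by
    intro S
    induction S using Finset.induction_on with
    | empty => simpa using hc
    | insert a S ha ih =>
      intro J hJ
      refine (Finset.sum_congr rfl fun K _ => ?_).trans
        (sum_orderedProd_restrict ih a (decide (a ∈ K₀)) J hJ)
      simp only [Finset.forall_mem_insert, ite_and]
  have hJ : IsUnits (fun _ : Fin n => qi) := fun _ => qi_mul_qi
  have h1 := key Finset.univ _ hJ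
  rw [Finset.sum_eq_single K₀] at h1
  · simpa [orderedProd_ne_zero K₀ hJ] using h1
  · intro K _ hK
    rw [if_neg, mul_zero]
    intro h
    exact hK (Finset.ext fun k => by simpa using h k (Finset.mem_univ k))
  · simp

theorem eq_of_sum_orderedProd {c d : Finset (Fin n) → ℍ[ℝ]}
    (h : ∀ J, IsUnits J → ∑ K, orderedProd K J * c K = ∑ K, orderedProd K J * d K) : c = d := by
  rw [← sub_eq_zero]
  refine eq_zero_of_sum_orderedProd fun J hJ => ?_
  simp only [Pi.sub_apply, mul_sub, Finset.sum_sub_distrib, h J hJ, sub_self]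

theorem point_conjAt (z : Fin n → ℂ) (J : Fin n → ℍ[ℝ]) (h : Fin n) :
    point (conjAt h z) J = point z (Function.update J h (-J h)) := by
  funext k
  by_cases hk : k = h
  · subst hk; simp [point, conjAt]
  · simp [point, conjAt, hk]

/-- The functions `J ↦ ∑ K, J_K c_K` of the tuple of units `J`. -/
noncomputable def sliceSpan (n : ℕ) : Submodule ℝ ({J : Fin n → ℍ[ℝ] // IsUnits J} → ℍ[ℝ]) :=
  LinearMap.range
    ({ toFun := fun c J => ∑ K, orderedProd K J.1 * c K
       map_add' := fun c d => by
         funext J; simp [mul_add, Finset.sum_add_distrib]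
       map_smul' := fun a c => by
         funext J; simp [Finset.smul_sum] } :
      (Finset (Fin n) → ℍ[ℝ]) →ₗ[ℝ] ({J : Fin n → ℍ[ℝ] // IsUnits J} → ℍ[ℝ]))

theorem mem_sliceSpan {g : {J : Fin n → ℍ[ℝ] // IsUnits J} → ℍ[ℝ]} :
    g ∈ sliceSpan n ↔ ∃ c : Finset (Fin n) → ℍ[ℝ], ∀ J, ∀ hJ : IsUnits J,
      g ⟨J, hJ⟩ = ∑ K, orderedProd K J * c K := by
  constructor
  · rintro ⟨c, rfl⟩
    exact ⟨c, fun J hJ => rfl⟩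
  · rintro ⟨c, hc⟩
    exact ⟨c, funext fun J => (hc J.1 J.2).symm⟩

/-- Closedness is in the product topology, so limits taken separately for each `J` stay in the
space. -/
theorem isClosed_sliceSpan : IsClosed (sliceSpan n : Set ({J : Fin n → ℍ[ℝ] // IsUnits J} → ℍ[ℝ])) := by
  have : FiniteDimensional ℝ (sliceSpan n) := by
    unfold sliceSpan; infer_instance
  exact Submodule.closed_of_finiteDimensional _

/-- Coefficients may be chosen point by point: their parity under conjugation is forced by
uniqueness, because conjugating `z_h` has the same effect as changing the sign of `J_h`. -/
theorem isSlice_of_mem_sliceSpan {D : Set (Fin n → ℂ)} (hD : IsConjInvariant D)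
    {g : (Fin n → ℍ[ℝ]) → ℍ[ℝ]} (hg : ∀ z ∈ D,
      (fun J : {J : Fin n → ℍ[ℝ] // IsUnits J} => g (point z J.1)) ∈ sliceSpan n) :
    IsSlice D g := by
  have h1 : ∀ z, ∃ c : Finset (Fin n) → ℍ[ℝ], z ∈ D → ∀ J, IsUnits J →
      g (point z J) = ∑ K, orderedProd K J * c K := by
    intro z
    by_cases hz : z ∈ D
    · obtain ⟨c, hc⟩ := mem_sliceSpan.1 (hg z hz)
      exact ⟨c, fun _ => hc⟩
    · exact ⟨0, fun h => absurd h hz⟩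
  choose F hF using h1
  refine ⟨F, ⟨hD, fun z hz h K => ?_⟩, fun z hz J hJ => hF z hz J hJ⟩
  rw [neg_one_pow_card_inter]
  refine congrFun (a := K) (eq_of_sum_orderedProd (c := F (conjAt h z))
    (d := fun K => (if h ∈ K then (-1 : ℝ) else 1) • F z K) fun J hJ => ?_)
  rw [← hF _ ((hD z h).1 hz) J hJ, point_conjAt, hF z hz _ (hJ.update_neg h),
    sum_orderedProd_update_neg]

theorem IsSlice.mem_sliceSpan {D : Set (Fin n → ℂ)} {g : (Fin n → ℍ[ℝ]) → ℍ[ℝ]}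
    (hg : IsSlice D g) {z : Fin n → ℂ} (hz : z ∈ D) :
    (fun J : {J : Fin n → ℍ[ℝ] // IsUnits J} => g (point z J.1)) ∈ sliceSpan n := by
  obtain ⟨F, -, hF⟩ := hg
  exact SliceFueter.mem_sliceSpan.2 ⟨F z, fun J hJ => hF z hz J hJ⟩

theorem IsSlice.update_neg_mem_sliceSpan {D : Set (Fin n → ℂ)} {g : (Fin n → ℍ[ℝ]) → ℍ[ℝ]}
    (hg : IsSlice D g) {z : Fin n → ℂ} (hz : z ∈ D) (m : Fin n) :
    (fun J : {J : Fin n → ℍ[ℝ] // IsUnits J} => g (point z (Function.update J.1 m (-J.1 m))))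
      ∈ sliceSpan n := by
  obtain ⟨F, -, hF⟩ := hg
  refine SliceFueter.mem_sliceSpan.2
    ⟨fun K => (if m ∈ K then (-1 : ℝ) else 1) • F z K, fun J hJ => ?_⟩
  rw [← sum_orderedProd_update_neg]
  exact hF z hz _ (hJ.update_neg m)

end SliceSpan

/-! ### The Laplacian is a slice function -/

section LaplacianSlice

open Metric

variable {n : ℕ} {m : Fin n} {D : Set (Fin n → ℂ)} {f : (Fin n → ℍ[ℝ]) → ℍ[ℝ]}

theorem update_point (z : Fin n → ℂ) (J : Fin n → ℍ[ℝ]) (I : ℍ[ℝ]) (ζ : ℂ) :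
    Function.update (point z J) m (slicePoint I ζ)
      = point (Function.update z m ζ) (Function.update J m I) := by
  funext k
  by_cases hk : k = m
  · subst hk; simp [point, slicePoint]
  · simp [point, hk]

theorem point_mem_circ {z : Fin n → ℂ} (hz : z ∈ D) {J : Fin n → ℍ[ℝ]} (hJ : IsUnits J) :
    point z J ∈ circ D := ⟨z, hz, J, hJ, rfl⟩

theorem mem_sliceDomain_point {z : Fin n → ℂ} {J : Fin n → ℍ[ℝ]} (hJ : IsUnits J) {ζ : ℂ}
    (hζ : Function.update z m ζ ∈ D) : ζ ∈ sliceDomain D m (point z J) := by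
  rw [sliceDomain, Set.mem_ofPred_eq, update_point]
  exact point_mem_circ hζ (hJ.update m qi_mul_qi)

theorem IsSliceRegularIn.slice_parts (ho : IsOpen D) (hD : IsConjInvariant D)
    (hf : IsSliceRegularIn D m f) {z : Fin n → ℂ} (hz : z ∈ D) {ζ : ℂ}
    (hζ : Function.update z m ζ ∈ D) {J : Fin n → ℍ[ℝ]} (hJ : IsUnits J) :
    sliceEven f m (point z J) ζ = (1 / 2 : ℝ) • (f (point (Function.update z m ζ) J)
      + f (point (Function.update z m ζ) (Function.update J m (-J m)))) ∧
    J m * sliceOdd f m (point z J) ζ = (1 / 2 : ℝ) • (f (point (Function.update z m ζ) J)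
      - f (point (Function.update z m ζ) (Function.update J m (-J m)))) := by
  have h := (hf.isHolPair ho hD (point_mem_circ hz hJ)).2 ζ (mem_sliceDomain_point hJ hζ)
  have h1 := h (J m) (hJ m)
  have h2 := h (-J m) (by rw [neg_mul_neg]; exact hJ m)
  rw [update_point, Function.update_eq_self] at h1
  rw [update_point] at h2
  rw [h1, h2, neg_mul]
  constructor <;> module

/-- At `z` the Laplacian is four times the `s`-derivative, at `s = β²`, of `A(α, s) + β J_m B(α, s)`
with the factor `β` frozen. The even part gives `A`, the odd part gives `√s J_m B`, and as functions
of `J` both lie in `sliceSpan n`. -/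
theorem IsSliceRegularIn.isSlice_lapl (ho : IsOpen D) (hD : IsConjInvariant D)
    (hf : IsSliceRegularIn D m f) : IsSlice D (lapl m f) := by
  refine isSlice_of_mem_sliceSpan hD fun z hz => ?_
  set w : ℝ → ℂ := fun s => ⟨(z m).re, √s⟩ with hw
  have hwc : Continuous w := by
    have : w = fun s => ((z m).re : ℂ) + ((√s : ℝ) : ℂ) * Complex.I := by
      funext s; apply Complex.ext <;> simp [hw]
    rw [this]; fun_prop
  set s₀ : ℝ := (z m).im ^ 2 with hs₀
  have hw₀ : w s₀ = ⟨(z m).re, |(z m).im|⟩ := by simp only [hw, hs₀, Real.sqrt_sq_eq_abs]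
  have hz₀ : Function.update z m (w s₀) ∈ D := by
    refine hD.mem_of_eq_or_conj hz fun h => ?_
    by_cases hh : h = m
    · subst hh
      rw [Function.update_self, hw₀, ← upperPoint_slicePoint qi_mul_qi]
      exact upperPoint_slicePoint_cases qi_mul_qi (z h)
    · exact Or.inl (by simp [hh])
  -- The limit is taken from the right because `s₀` may be `0`, and only `s ≥ 0` corresponds to
  -- points of the slice.
  have hev : ∀ᶠ s in 𝓝[>] s₀, Function.update z m (w s) ∈ D := by
    have hc : Continuous fun s => Function.update z m (w s) := continuous_const.update m hwc
    exact (hc.continuousAt.eventually_mem (ho.mem_nhds hz₀)).filter_mono nhdsWithin_le_nhds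
  set β := (z m).im with hβ
  set e : ℝ → {J : Fin n → ℍ[ℝ] // IsUnits J} → ℍ[ℝ] :=
    fun s J => sliceEven f m (point z J.1) (w s) with he
  set o : ℝ → {J : Fin n → ℍ[ℝ] // IsUnits J} → ℍ[ℝ] :=
    fun s J => J.1 m * sliceOdd f m (point z J.1) (w s) with hoo
  have hmem : ∀ s, Function.update z m (w s) ∈ D → e s ∈ sliceSpan n ∧ o s ∈ sliceSpan n := by
    intro s hs
    have m1 := hf.1.mem_sliceSpan hs
    have m2 := hf.1.update_neg_mem_sliceSpan hs m
    constructor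
    · convert (sliceSpan n).smul_mem (1 / 2 : ℝ) ((sliceSpan n).add_mem m1 m2) using 1
      funext J
      exact (hf.slice_parts ho hD hz hs J.2).1
    · convert (sliceSpan n).smul_mem (1 / 2 : ℝ) ((sliceSpan n).sub_mem m1 m2) using 1
      funext J
      exact (hf.slice_parts ho hD hz hs J.2).2
  -- Four times the difference quotient. For `s₀ = 0` the term `(√s₀)⁻¹` is `0` by convention,
  -- harmless since then `β = 0`.
  set Φ : ℝ → {J : Fin n → ℍ[ℝ] // IsUnits J} → ℍ[ℝ] := fun s =>
    (4 * (s - s₀)⁻¹) • ((e s - e s₀) + β • ((√s)⁻¹ • o s - (√s₀)⁻¹ • o s₀)) with hΦ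
  have hΦm : ∀ᶠ s in 𝓝[>] s₀, Φ s ∈ (sliceSpan n : Set _) := by
    filter_upwards [hev] with s hs
    obtain ⟨a1, a2⟩ := hmem s hs
    obtain ⟨b1, b2⟩ := hmem s₀ hz₀
    exact (sliceSpan n).smul_mem _ ((sliceSpan n).add_mem ((sliceSpan n).sub_mem a1 b1)
      ((sliceSpan n).smul_mem _ ((sliceSpan n).sub_mem ((sliceSpan n).smul_mem _ a2)
        ((sliceSpan n).smul_mem _ b2))))
  refine isClosed_sliceSpan.mem_of_tendsto (b := 𝓝[>] s₀) (f := Φ) ?_ hΦm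
  rw [tendsto_pi_nhds]
  rintro ⟨J, hJ⟩
  set y := point z J with hy
  have hyc : y ∈ circ D := point_mem_circ hz hJ
  have hym : y m = slicePoint (J m) (z m) := rfl
  have hup : upperPoint (y m) = w s₀ := by rw [hym, upperPoint_slicePoint (hJ m), hw₀]
  -- The radius may depend on `J`, since the convergence is only pointwise in `J`.
  obtain ⟨r, ha⟩ := exists_isAdmissible ho hD (mem_sliceDomain_point (J := J) hJ hz₀)
  obtain ⟨hF, hSo, hSV, hrep⟩ := hf.representation ho hD hyc ha
  obtain ⟨hp, -⟩ := hf.isHolPair ho hD hyc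
  have hyS : y m ∈ upperPoint ⁻¹' ball (w s₀) r := by
    rw [mem_preimage, hup]; exact mem_ball_self ha.pos
  have hlap : lapl m f y = (4 : ℝ) • sliceSeq (cauchyEven f m (w s₀) r y)
      (cauchyOdd f m (w s₀) r y) 1 (y m) := by
    have := hF.lapl_eq hSo hSV hrep (y m) hyS
    rwa [Function.update_eq_self] at this
  have hq : reImSq (y m) = ((z m).re, s₀) := by
    rw [reImSq_eq_upperPoint, hup, hw₀]
    simp [hs₀]
  have hqV : ((z m).re, s₀) ∈ kernelDomain (w s₀) r := hq ▸ hSV _ hyS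
  have him : (y m).im = β • J m := im_slicePoint (hJ m) (z m)
  have hline : HasDerivAt (fun s : ℝ => ((z m).re, s)) (0, 1) s₀ :=
    (hasDerivAt_const s₀ (z m).re).prodMk (hasDerivAt_id s₀)
  have dA : HasDerivAt (fun s => cauchyEven f m (w s₀) r y 0 ((z m).re, s))
      (cauchyEven f m (w s₀) r y 1 ((z m).re, s₀)) s₀ := by
    refine ((hF.even 0 _ hqV).comp_hasDerivAt s₀ hline).congr_deriv ?_
    simp
  have dB : HasDerivAt (fun s => cauchyOdd f m (w s₀) r y 0 ((z m).re, s))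
      (cauchyOdd f m (w s₀) r y 1 ((z m).re, s₀)) s₀ := by
    refine ((hF.odd 0 _ hqV).comp_hasDerivAt s₀ hline).congr_deriv ?_
    simp
  have hball : ∀ᶠ s in 𝓝[>] s₀, w s ∈ ball (w s₀) r :=
    (hwc.continuousAt.eventually_mem (ball_mem_nhds _ ha.pos)).filter_mono nhdsWithin_le_nhds
  have hval : ∀ s, 0 ≤ s → w s ∈ ball (w s₀) r →
      cauchyEven f m (w s₀) r y 0 ((z m).re, s) = e s ⟨J, hJ⟩ ∧
      √s • (J m * cauchyOdd f m (w s₀) r y 0 ((z m).re, s)) = o s ⟨J, hJ⟩ := by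
    intro s hs hsb
    obtain ⟨h0, h1⟩ := hp.symmCauchy_eq ha.subset ha.lt_im hsb
    have hsq : (w s).im ^ 2 = s := Real.sq_sqrt hs
    rw [hsq] at h0 h1
    refine ⟨h0, ?_⟩
    rw [← mul_smul_comm]
    exact congrArg (J m * ·) h1
  have hs₀0 : 0 ≤ s₀ := sq_nonneg _
  have lim := ((hasDerivAt_iff_tendsto_slope.1
    ((dA.add (((dB.const_mul (J m)).const_smul β))).const_smul (4 : ℝ))).mono_left
      (nhdsWithin_mono s₀ (fun s (hs : s₀ < s) => hs.ne')))
  rw [hlap, sliceSeq, hq, him, smul_mul_assoc]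
  refine lim.congr' ?_
  filter_upwards [hball, self_mem_nhdsWithin] with s hs hs'
  have hs' : s₀ < s := hs'
  obtain ⟨a1, a2⟩ := hval s (hs₀0.trans hs'.le) hs
  obtain ⟨b1, b2⟩ := hval s₀ hs₀0 (mem_ball_self ha.pos)
  have a3 : J m * cauchyOdd f m (w s₀) r y 0 ((z m).re, s) = (√s)⁻¹ • o s ⟨J, hJ⟩ := by
    rw [← a2, smul_smul, inv_mul_cancel₀ (Real.sqrt_pos.2 (hs₀0.trans_lt hs')).ne', one_smul]
  have b3 : β • (J m * cauchyOdd f m (w s₀) r y 0 ((z m).re, s₀))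
      = β • (√s₀)⁻¹ • o s₀ ⟨J, hJ⟩ := by
    by_cases hb : β = 0
    · simp [hb]
    · have : √s₀ ≠ 0 := by rw [hs₀, Real.sqrt_sq_eq_abs]; exact abs_ne_zero.2 hb
      rw [← b2, smul_smul (√s₀)⁻¹, inv_mul_cancel₀ this, one_smul]
  simp only [slope_def_module, Pi.add_apply, Pi.smul_apply, hΦ, Pi.sub_apply, a1, b1, a3, b3,
    smul_sub β]
  module

end LaplacianSlice

/-! ### `C¹` stem functions of one variable with parameters induce `C¹` functions -/

section OneVariable

theorem abs_re_le_norm (q : ℍ[ℝ]) : |q.re| ≤ ‖q‖ := by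
  refine abs_le_of_sq_le_sq ?_ (norm_nonneg q)
  rw [sq ‖q‖, ← Quaternion.normSq_eq_norm_mul_self, Quaternion.normSq_def']
  nlinarith [sq_nonneg q.imI, sq_nonneg q.imJ, sq_nonneg q.imK]

theorem norm_im_le_norm (q : ℍ[ℝ]) : ‖q.im‖ ≤ ‖q‖ := by
  refine abs_le_of_sq_le_sq' ?_ (norm_nonneg q) |>.2
  rw [← imInner_self, sq ‖q‖, ← Quaternion.normSq_eq_norm_mul_self, Quaternion.normSq_def', imInner]
  nlinarith [sq_nonneg q.re]

theorem norm_unitOf (x : ℍ[ℝ]) : ‖unitOf x‖ = 1 :=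
  (re_eq_zero_of_mul_self (unitOf_mul_self x)).2

theorem abs_norm_im_sub_le (x y : ℍ[ℝ]) : |‖x.im‖ - ‖y.im‖| ≤ ‖(x - y).im‖ := by
  rw [Quaternion.im_sub]
  exact abs_norm_sub_norm_le _ _

/-- The unit is discontinuous at real points; weighted by `‖y.im‖` it still satisfies a Lipschitz
estimate, which controls the odd part there. -/
theorem norm_unitOf_sub_mul_le (x y : ℍ[ℝ]) :
    ‖unitOf x - unitOf y‖ * ‖y.im‖ ≤ 2 * ‖(x - y).im‖ := by
  have h : ‖y.im‖ • (unitOf x - unitOf y) = (‖y.im‖ - ‖x.im‖) • unitOf x + (x - y).im := by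
    rw [smul_sub, sub_smul, unitOf_smul, unitOf_smul, Quaternion.im_sub]
    abel
  have h1 : ‖‖y.im‖ • (unitOf x - unitOf y)‖ = ‖unitOf x - unitOf y‖ * ‖y.im‖ := by
    rw [norm_smul, norm_norm, mul_comm]
  rw [← h1, h]
  refine (norm_add_le _ _).trans ?_
  rw [norm_smul, norm_unitOf, mul_one, Real.norm_eq_abs, abs_sub_comm]
  linarith [abs_norm_im_sub_le x y]

theorem norm_upperPoint_sub_le (x y : ℍ[ℝ]) : ‖upperPoint x - upperPoint y‖ ≤ 2 * ‖x - y‖ := by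
  refine (Complex.norm_le_abs_re_add_abs_im _).trans ?_
  have h1 := abs_re_le_norm (x - y)
  have h2 := (abs_norm_im_sub_le x y).trans (norm_im_le_norm (x - y))
  simp only [Complex.sub_re, Complex.sub_im, upperPoint]
  rw [Quaternion.re_sub] at h1
  linarith

variable {P : Type*} [NormedAddCommGroup P] [NormedSpace ℝ P]

theorem contDiffAt_upperPoint {x : ℍ[ℝ]} (hx : x.im ≠ 0) : ContDiffAt ℝ 1 upperPoint x := by
  have h : upperPoint = fun x : ℍ[ℝ] => Complex.ofRealCLM x.re
      + Complex.ofRealCLM ‖x.im‖ * Complex.I := by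
    funext x; apply Complex.ext <;> simp [upperPoint]
  rw [h]
  refine (Complex.ofRealCLM.contDiff.contDiffAt.comp x reQ.contDiff.contDiffAt).add
    ((Complex.ofRealCLM.contDiff.contDiffAt.comp x ?_).mul contDiffAt_const)
  exact contDiff_imQ.contDiffAt.norm ℝ hx

theorem contDiffAt_unitOf {x : ℍ[ℝ]} (hx : x.im ≠ 0) : ContDiffAt ℝ 1 unitOf x := by
  have h : ContDiffAt ℝ 1 (fun x : ℍ[ℝ] => ‖x.im‖⁻¹ • x.im) x :=
    ((contDiff_imQ.contDiffAt.norm ℝ hx).inv (norm_ne_zero_iff.2 hx)).smul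
      contDiff_imQ.contDiffAt
  refine h.congr_of_eventuallyEq ?_
  filter_upwards [Quaternion.continuous_im.continuousAt.eventually_ne hx] with y hy
  rw [unitOf, if_neg hy]

/-- At real points `upperPoint` is not differentiable, but it is Lipschitz, and that is enough to
transport the error term of a strict derivative. -/
theorem hasStrictFDerivAt_comp_upperPoint {a : ℂ × P → ℍ[ℝ]} {L : ℂ × P →L[ℝ] ℍ[ℝ]} {x₀ : ℍ[ℝ]}
    {p₀ : P} (ha : HasStrictFDerivAt a L (upperPoint x₀, p₀)) :
    (fun z : (ℍ[ℝ] × P) × (ℍ[ℝ] × P) => a (upperPoint z.1.1, z.1.2) - a (upperPoint z.2.1, z.2.2)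
      - L (upperPoint z.1.1 - upperPoint z.2.1, z.1.2 - z.2.2))
      =o[𝓝 ((x₀, p₀), (x₀, p₀))] fun z => z.1 - z.2 := by
  have hc : Continuous fun x : ℍ[ℝ] × P => (upperPoint x.1, x.2) :=
    (continuous_upperPoint.comp continuous_fst).prodMk continuous_snd
  have ht : Tendsto (fun z : (ℍ[ℝ] × P) × (ℍ[ℝ] × P) =>
      ((upperPoint z.1.1, z.1.2), (upperPoint z.2.1, z.2.2))) (𝓝 ((x₀, p₀), (x₀, p₀)))
      (𝓝 ((upperPoint x₀, p₀), (upperPoint x₀, p₀))) :=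
    ((hc.comp continuous_fst).prodMk (hc.comp continuous_snd)).tendsto' _ _ rfl
  refine (ha.isLittleO.comp_tendsto ht).trans_isBigO (Asymptotics.IsBigO.of_bound 2 ?_)
  refine Eventually.of_forall fun z => ?_
  simp only [Function.comp_apply, Prod.mk_sub_mk]
  rw [Prod.norm_mk, max_le_iff]
  constructor
  · refine (norm_upperPoint_sub_le _ _).trans ?_
    have := norm_fst_le (z.1 - z.2)
    simp only [Prod.fst_sub] at this
    linarith
  · have := norm_snd_le (z.1 - z.2)
    simp only [Prod.snd_sub] at this
    linarith [norm_nonneg (z.1 - z.2)]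

/-- The conjugation of the first factor. -/
noncomputable def conjFst (P : Type*) [NormedAddCommGroup P] [NormedSpace ℝ P] :
    ℂ × P →L[ℝ] ℂ × P :=
  (Complex.conjCLE : ℂ →L[ℝ] ℂ).prodMap (ContinuousLinearMap.id ℝ P)

theorem conjFst_apply (w : ℂ × P) : conjFst P w = ((starRingEnd ℂ) w.1, w.2) := rfl

/-- Evenness forces `L` to vanish in the direction of `Complex.I`, the only one in which
`upperPoint` fails to be differentiable. -/
theorem hasStrictFDerivAt_even {a : ℂ × P → ℍ[ℝ]} {L : ℂ × P →L[ℝ] ℍ[ℝ]} {x₀ : ℍ[ℝ]}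
    {p₀ : P} (ha : HasStrictFDerivAt a L (upperPoint x₀, p₀)) (hx₀ : x₀.im = 0)
    (he : ∀ᶠ w in 𝓝 (upperPoint x₀, p₀), a (conjFst P w) = a w) :
    HasStrictFDerivAt (fun x : ℍ[ℝ] × P => a (upperPoint x.1, x.2))
      (L.comp ((Complex.ofRealCLM.comp reQ).prodMap (ContinuousLinearMap.id ℝ P))) (x₀, p₀) := by
  have hfix : conjFst P (upperPoint x₀, p₀) = (upperPoint x₀, p₀) := by
    rw [conjFst_apply]
    simp [upperPoint, hx₀, Complex.conj_eq_iff_im]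
  have h1 : HasFDerivAt (fun w => a (conjFst P w)) (L.comp (conjFst P)) (upperPoint x₀, p₀) := by
    have : HasFDerivAt a L (conjFst P (upperPoint x₀, p₀)) := by
      rw [hfix]; exact ha.hasFDerivAt
    exact this.comp _ (conjFst P).hasFDerivAt
  have h2 := (h1.congr_of_eventuallyEq (he.mono fun w hw => hw.symm)).unique ha.hasFDerivAt
  have h3 : L (Complex.I, 0) = 0 := by
    have h4 := congrArg (fun T => T (Complex.I, (0 : P))) h2
    simp only [ContinuousLinearMap.comp_apply, conjFst_apply, Complex.conj_I] at h4
    have h5 : ((-Complex.I, 0) : ℂ × P) = -(Complex.I, 0) := by simp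
    rw [h5, map_neg, neg_eq_iff_add_eq_zero, ← two_smul ℝ, smul_eq_zero] at h4
    exact h4.resolve_left two_ne_zero
  refine .of_isLittleO ((hasStrictFDerivAt_comp_upperPoint ha).congr_left fun z => ?_)
  have h6 : ((upperPoint z.1.1 - upperPoint z.2.1, z.1.2 - z.2.2) : ℂ × P)
      = ((((z.1.1 - z.2.1).re : ℝ) : ℂ), z.1.2 - z.2.2)
        + (‖z.1.1.im‖ - ‖z.2.1.im‖) • (Complex.I, (0 : P)) := by
    refine Prod.ext (Complex.ext ?_ ?_) ?_ <;> simp [upperPoint]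
  rw [h6, map_add, map_smul, h3, smul_zero, add_zero]
  rfl

/-- Oddness leaves only the derivative `c` in the direction of `Complex.I`, so `b` is `‖Im x‖ c` to
first order, and multiplying by the unit gives the linear term `Im x · c`. -/
theorem hasStrictFDerivAt_odd {b : ℂ × P → ℍ[ℝ]} {L : ℂ × P →L[ℝ] ℍ[ℝ]} {x₀ : ℍ[ℝ]}
    {p₀ : P} (hb : HasStrictFDerivAt b L (upperPoint x₀, p₀)) (hx₀ : x₀.im = 0)
    (he : ∀ᶠ w in 𝓝 (upperPoint x₀, p₀), b (conjFst P w) = -b w) :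
    HasStrictFDerivAt (fun x : ℍ[ℝ] × P => unitOf x.1 * b (upperPoint x.1, x.2))
      (((ContinuousLinearMap.mul ℝ ℍ[ℝ]).flip (L (Complex.I, 0))).comp
        (imQ.comp (ContinuousLinearMap.fst ℝ ℍ[ℝ] P))) (x₀, p₀) := by
  have hfix : conjFst P (upperPoint x₀, p₀) = (upperPoint x₀, p₀) := by
    rw [conjFst_apply]
    simp [upperPoint, hx₀, Complex.conj_eq_iff_im]
  have h1 : HasFDerivAt (fun w => b (conjFst P w)) (L.comp (conjFst P)) (upperPoint x₀, p₀) := by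
    have : HasFDerivAt b L (conjFst P (upperPoint x₀, p₀)) := by
      rw [hfix]; exact hb.hasFDerivAt
    exact this.comp _ (conjFst P).hasFDerivAt
  have h2 : L.comp (conjFst P) = -L :=
    (h1.congr_of_eventuallyEq (he.mono fun w hw => hw.symm)).unique hb.hasFDerivAt.neg
  have h3 : ∀ (t : ℝ) (p : P), L ((t : ℂ), p) = 0 := by
    intro t p
    have h4 := congrArg (fun T => T ((t : ℂ), p)) h2
    simp only [ContinuousLinearMap.comp_apply, conjFst_apply, Complex.conj_ofReal,
      _root_.neg_apply] at h4
    rw [eq_neg_iff_add_eq_zero, ← two_smul ℝ, smul_eq_zero] at h4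
    exact h4.resolve_left two_ne_zero
  set c := L (Complex.I, 0) with hc
  -- The remainder `β` has strict derivative `0` and vanishes at real points near `x₀`. Comparing
  -- `y` with its real part thus gives `‖β (y, q)‖ ≤ ε/3 · ‖y.im‖`, the weight needed in
  -- `norm_unitOf_sub_mul_le`.
  set β : ℍ[ℝ] × P → ℍ[ℝ] := fun x => b (upperPoint x.1, x.2) - ‖x.1.im‖ • c with hβ
  have h4 : (fun z : (ℍ[ℝ] × P) × (ℍ[ℝ] × P) => β z.1 - β z.2)
      =o[𝓝 ((x₀, p₀), (x₀, p₀))] fun z => z.1 - z.2 := by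
    refine (hasStrictFDerivAt_comp_upperPoint hb).congr_left fun z => ?_
    have h6 : ((upperPoint z.1.1 - upperPoint z.2.1, z.1.2 - z.2.2) : ℂ × P)
        = ((((z.1.1 - z.2.1).re : ℝ) : ℂ), z.1.2 - z.2.2)
          + (‖z.1.1.im‖ - ‖z.2.1.im‖) • (Complex.I, (0 : P)) := by
      refine Prod.ext (Complex.ext ?_ ?_) ?_ <;> simp [upperPoint]
    rw [h6, map_add, map_smul, h3, zero_add, ← hc, sub_smul]
    simp only [hβ]
    abel
  have hπ : Continuous fun z : (ℍ[ℝ] × P) × (ℍ[ℝ] × P) =>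
      (z.2, (((z.2.1.re : ℝ) : ℍ[ℝ]), z.2.2)) := by
    refine continuous_snd.prodMk (Continuous.prodMk ?_ (continuous_snd.comp continuous_snd))
    exact Quaternion.continuous_coe.comp (Quaternion.continuous_re.comp
      (continuous_fst.comp continuous_snd))
  have hx₀' : ((x₀.re : ℝ) : ℍ[ℝ]) = x₀ := by
    conv_rhs => rw [← Quaternion.re_add_im x₀, hx₀, add_zero]
  have hπt : Tendsto (fun z : (ℍ[ℝ] × P) × (ℍ[ℝ] × P) =>
      (z.2, (((z.2.1.re : ℝ) : ℍ[ℝ]), z.2.2))) (𝓝 ((x₀, p₀), (x₀, p₀)))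
      (𝓝 ((x₀, p₀), (x₀, p₀))) := hπ.tendsto' _ _ (by simp only [hx₀'])
  have hzero : ∀ᶠ z : (ℍ[ℝ] × P) × (ℍ[ℝ] × P) in 𝓝 ((x₀, p₀), (x₀, p₀)),
      β (((z.2.1.re : ℝ) : ℍ[ℝ]), z.2.2) = 0 := by
    have ht : Tendsto (fun z : (ℍ[ℝ] × P) × (ℍ[ℝ] × P) =>
        (upperPoint ((z.2.1.re : ℝ) : ℍ[ℝ]), z.2.2)) (𝓝 ((x₀, p₀), (x₀, p₀)))
        (𝓝 (upperPoint x₀, p₀)) := by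
      refine Continuous.tendsto' ?_ _ _ (by simp only [hx₀'])
      exact (continuous_upperPoint.comp (Quaternion.continuous_coe.comp
        (Quaternion.continuous_re.comp (continuous_fst.comp continuous_snd)))).prodMk
        (continuous_snd.comp continuous_snd)
    filter_upwards [ht.eventually he] with z hz
    have h7 : conjFst P (upperPoint ((z.2.1.re : ℝ) : ℍ[ℝ]), z.2.2)
        = (upperPoint ((z.2.1.re : ℝ) : ℍ[ℝ]), z.2.2) := by
      rw [conjFst_apply]
      simp [upperPoint, Complex.conj_eq_iff_im]
    rw [h7, eq_neg_iff_add_eq_zero, ← two_smul ℝ, smul_eq_zero] at hz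
    simp only [hβ, hz.resolve_left two_ne_zero, Quaternion.im_coe, norm_zero, zero_smul, sub_zero]
  refine .of_isLittleO (Asymptotics.isLittleO_iff.2 fun ε hε => ?_)
  have h8 := h4.def (c := ε / 3) (by positivity)
  filter_upwards [h8, hπt.eventually h8, hzero] with z hz1 hz2 hz3
  obtain ⟨⟨x, p⟩, ⟨y, q⟩⟩ := z
  simp only at hz1 hz2 hz3
  rw [hz3, sub_zero] at hz2
  have e1 : ∀ (x : ℍ[ℝ]) (p : P), unitOf x * b (upperPoint x, p)
      = unitOf x * β (x, p) + x.im * c := by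
    intro x p
    simp only [hβ, mul_sub, mul_smul_comm]
    rw [← smul_mul_assoc, unitOf_smul, sub_add_cancel]
  have e2 : unitOf x * b (upperPoint x, p) - unitOf y * b (upperPoint y, q)
      - (((ContinuousLinearMap.mul ℝ ℍ[ℝ]).flip c).comp
        (imQ.comp (ContinuousLinearMap.fst ℝ ℍ[ℝ] P))) ((x, p) - (y, q))
      = unitOf x * (β (x, p) - β (y, q)) + (unitOf x - unitOf y) * β (y, q) := by
    rw [e1, e1]
    simp only [ContinuousLinearMap.comp_apply, ContinuousLinearMap.flip_apply,
      ContinuousLinearMap.mul_apply', imQ_apply, ContinuousLinearMap.coe_fst', Prod.mk_sub_mk,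
      Quaternion.im_sub]
    noncomm_ring
  have e3 : ‖((y, q) : ℍ[ℝ] × P) - (((y.re : ℝ) : ℍ[ℝ]), q)‖ = ‖y.im‖ := by
    rw [Prod.mk_sub_mk, sub_self, Prod.norm_mk, norm_zero, max_eq_left (norm_nonneg _)]
    congr 1
    rw [sub_eq_iff_eq_add, add_comm]
    exact (Quaternion.re_add_im y).symm
  rw [e3] at hz2
  have e4 : ‖(x - y).im‖ ≤ ‖((x, p) : ℍ[ℝ] × P) - (y, q)‖ :=
    (norm_im_le_norm _).trans (norm_fst_le (((x, p) : ℍ[ℝ] × P) - (y, q)))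
  simp only [e2]
  refine (norm_add_le _ _).trans ?_
  rw [norm_mul, norm_mul, norm_unitOf, one_mul]
  have e5 : ‖unitOf x - unitOf y‖ * ‖β (y, q)‖ ≤ ε / 3 * (2 * ‖(x - y).im‖) := by
    calc ‖unitOf x - unitOf y‖ * ‖β (y, q)‖ ≤ ‖unitOf x - unitOf y‖ * (ε / 3 * ‖y.im‖) := by
          gcongr
      _ = ε / 3 * (‖unitOf x - unitOf y‖ * ‖y.im‖) := by ring
      _ ≤ _ := mul_le_mul_of_nonneg_left (norm_unitOf_sub_mul_le x y) (by positivity)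
  have e6 : ε / 3 * (2 * ‖(x - y).im‖) ≤ ε / 3 * (2 * ‖((x, p) : ℍ[ℝ] × P) - (y, q)‖) := by
    gcongr
  linarith

/-- A stem function of class `C¹` in one variable, depending on a parameter, induces a slice
function of class `C¹`. -/
theorem contDiffOn_slice_param {O : Set (ℂ × P)} (hO : IsOpen O) {a b : ℂ × P → ℍ[ℝ]}
    (ha : ContDiffOn ℝ 1 a O) (hb : ContDiffOn ℝ 1 b O)
    (hae : ∀ w ∈ O, a (conjFst P w) = a w) (hbo : ∀ w ∈ O, b (conjFst P w) = -b w) :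
    ContDiffOn ℝ 1 (fun x : ℍ[ℝ] × P => a (upperPoint x.1, x.2)
      + unitOf x.1 * b (upperPoint x.1, x.2)) {x | (upperPoint x.1, x.2) ∈ O} := by
  have hc : Continuous fun x : ℍ[ℝ] × P => (upperPoint x.1, x.2) :=
    (continuous_upperPoint.comp continuous_fst).prodMk continuous_snd
  have key : ∀ x ∈ {x : ℍ[ℝ] × P | (upperPoint x.1, x.2) ∈ O}, ∃ L : ℍ[ℝ] × P →L[ℝ] ℍ[ℝ],
      HasStrictFDerivAt
      (fun x : ℍ[ℝ] × P => a (upperPoint x.1, x.2) + unitOf x.1 * b (upperPoint x.1, x.2)) L x := by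
    rintro ⟨x, p⟩ hx
    have hn : O ∈ 𝓝 (upperPoint x, p) := hO.mem_nhds hx
    have ha' := ha.contDiffAt hn
    have hb' := hb.contDiffAt hn
    by_cases hx0 : x.im = 0
    · exact ⟨_, (hasStrictFDerivAt_even (ha'.hasStrictFDerivAt one_ne_zero) hx0
        (mem_of_superset hn hae)).add (hasStrictFDerivAt_odd
        (hb'.hasStrictFDerivAt one_ne_zero) hx0 (mem_of_superset hn hbo))⟩
    · have hu : ContDiffAt ℝ 1 (fun x : ℍ[ℝ] × P => (upperPoint x.1, x.2)) (x, p) :=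
        (ContDiffAt.comp (g := upperPoint) (x, p) (contDiffAt_upperPoint hx0)
          contDiffAt_fst).prodMk contDiffAt_snd
      have hv : ContDiffAt ℝ 1 (fun x : ℍ[ℝ] × P => unitOf x.1) (x, p) :=
        ContDiffAt.comp (g := unitOf) (x, p) (contDiffAt_unitOf hx0) contDiffAt_fst
      have ht := (ContDiffAt.comp (g := a) (x, p) ha' hu).add
        (hv.mul (ContDiffAt.comp (g := b) (x, p) hb' hu))
      exact ⟨_, ht.hasStrictFDerivAt one_ne_zero⟩
  choose! L hL using key
  exact contDiffOn_one_of_hasStrictFDerivAt (hO.preimage hc) hL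

end OneVariable

/-! ### `C¹` stem functions of several variables, one variable at a time -/

section SeveralVariables

variable {n : ℕ}

/-- `z` with the coordinates in `l` replaced by those of `upperPoint ∘ x`. -/
noncomputable def mixedPoint : List (Fin n) → (Fin n → ℂ) × (Fin n → ℍ[ℝ]) → (Fin n → ℂ)
  | [], p => p.1
  | h :: l, p => mixedPoint l (Function.update p.1 h (upperPoint (p.2 h)), p.2)

/-- The function obtained from a stem function by passing to the quaternionic variables in `l`. -/
noncomputable def partialSlice (F : (Fin n → ℂ) → Finset (Fin n) → ℍ[ℝ]) :
    List (Fin n) → (Fin n → ℂ) × (Fin n → ℍ[ℝ]) → Finset (Fin n) → ℍ[ℝ]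
  | [], p => F p.1
  | h :: l, p => fun K =>
      partialSlice F l (Function.update p.1 h (upperPoint (p.2 h)), p.2) K
        + unitOf (p.2 h) *
          partialSlice F l (Function.update p.1 h (upperPoint (p.2 h)), p.2) (insert h K)

theorem mixedPoint_apply (l : List (Fin n)) (p : (Fin n → ℂ) × (Fin n → ℍ[ℝ])) (k : Fin n) :
    mixedPoint l p k = if k ∈ l then upperPoint (p.2 k) else p.1 k := by
  induction l generalizing p with
  | nil => simp [mixedPoint]
  | cons h l ih =>
    rw [mixedPoint, ih]
    by_cases hk : k = h
    · subst hk; simp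
    · simp [hk]

theorem continuous_mixedPoint (l : List (Fin n)) : Continuous (mixedPoint l) := by
  refine continuous_pi fun k => ?_
  simp only [mixedPoint_apply]
  by_cases hk : k ∈ l
  · simp only [hk, if_true]
    exact continuous_upperPoint.comp ((continuous_apply k).comp continuous_snd)
  · simp only [hk, if_false]
    exact (continuous_apply k).comp continuous_fst

theorem conjAt_update_of_ne {h a : Fin n} (hne : h ≠ a) (z : Fin n → ℂ) (w : ℂ) :
    Function.update (conjAt h z) a w = conjAt h (Function.update z a w) := by
  rw [conjAt, conjAt, Function.update_comm hne.symm, Function.update_of_ne hne]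

theorem conjAt_update_self (a : Fin n) (z : Fin n → ℂ) (w : ℂ) :
    conjAt a (Function.update z a w) = Function.update z a ((starRingEnd ℂ) w) := by
  simp [conjAt]

variable {D : Set (Fin n → ℂ)} {F : (Fin n → ℂ) → Finset (Fin n) → ℍ[ℝ]}

theorem IsStem.partialSlice_conjAt (hF : IsStem D F) {l : List (Fin n)} {h : Fin n} (hl : h ∉ l)
    (p : (Fin n → ℂ) × (Fin n → ℍ[ℝ])) (hp : mixedPoint l p ∈ D) (K : Finset (Fin n)) :
    partialSlice F l (conjAt h p.1, p.2) K
      = (if h ∈ K then (-1 : ℝ) else 1) • partialSlice F l p K := by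
  induction l generalizing p K with
  | nil =>
    rw [← neg_one_pow_card_inter]
    exact hF.2 _ hp h K
  | cons a l ih =>
    rw [List.mem_cons, not_or] at hl
    have e := conjAt_update_of_ne hl.1 p.1 (upperPoint (p.2 a))
    simp only [partialSlice]
    rw [e, ih hl.2 (Function.update p.1 a (upperPoint (p.2 a)), p.2) hp,
      ih hl.2 (Function.update p.1 a (upperPoint (p.2 a)), p.2) hp, smul_add, mul_smul_comm]
    simp [hl.1]

/-- Keeping `K` disjoint from `l` makes the component at `K` even and the one at `insert a K` odd in
the variable `a`, as `contDiffOn_slice_param` requires; all remaining variables act as parameters.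
-/
theorem IsStem.contDiffOn_partialSlice (hF : IsStem D F) (ho : IsOpen D)
    (hF1 : ContDiffOn ℝ 1 F D) {l : List (Fin n)} (hl : l.Nodup) {K : Finset (Fin n)}
    (hK : ∀ k ∈ K, k ∉ l) :
    ContDiffOn ℝ 1 (fun p => partialSlice F l p K) (mixedPoint l ⁻¹' D) := by
  induction l generalizing K with
  | nil =>
    exact (contDiffOn_pi.1 hF1 K).comp contDiff_fst.contDiffOn fun p hp => hp
  | cons a l ih =>
    rw [List.nodup_cons] at hl
    have hKa : a ∉ K := fun h => hK a h List.mem_cons_self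
    have hKl : ∀ k ∈ K, k ∉ l := fun k hk h => hK k hk (List.mem_cons_of_mem a h)
    have hKl' : ∀ k ∈ insert a K, k ∉ l := by
      intro k hk
      rcases Finset.mem_insert.1 hk with rfl | hk
      · exact hl.1
      · exact hKl k hk
    set ψ : ℂ × ((Fin n → ℂ) × (Fin n → ℍ[ℝ])) → (Fin n → ℂ) × (Fin n → ℍ[ℝ]) :=
      fun w => (Function.update w.2.1 a w.1, w.2.2) with hψ
    have hψc : ContDiff ℝ 1 ψ :=
      (contDiff_update_param.comp ((contDiff_fst.comp contDiff_snd).prodMk contDiff_fst)).prodMk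
        (contDiff_snd.comp contDiff_snd)
    have hO : IsOpen (ψ ⁻¹' (mixedPoint l ⁻¹' D)) :=
      (ho.preimage (continuous_mixedPoint l)).preimage hψc.continuous
    have hconj : ∀ w, ψ (conjFst _ w) = (conjAt a (ψ w).1, (ψ w).2) := by
      intro w
      simp only [hψ, conjFst_apply, conjAt_update_self]
    have h1 := contDiffOn_slice_param hO
      (a := fun w => partialSlice F l (ψ w) K)
      (b := fun w => partialSlice F l (ψ w) (insert a K))
      ((ih hl.2 hKl).comp hψc.contDiffOn fun w hw => hw)
      ((ih hl.2 hKl').comp hψc.contDiffOn fun w hw => hw)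
      (fun w hw => by
        rw [hconj, hF.partialSlice_conjAt hl.1 _ hw]
        simp [hKa])
      (fun w hw => by
        rw [hconj, hF.partialSlice_conjAt hl.1 _ hw]
        simp)
    have h2 : ContDiff ℝ 1 fun p : (Fin n → ℂ) × (Fin n → ℍ[ℝ]) => (p.2 a, p) :=
      ((contDiff_apply ℝ ℍ[ℝ] a).comp contDiff_snd).prodMk contDiff_id
    exact h1.comp h2.contDiffOn fun p hp => hp

theorem orderedProd_insert {h : Fin n} {Q : Finset (Fin n)} (hQ : ∀ k ∈ Q, h < k)
    (J : Fin n → ℍ[ℝ]) : orderedProd (insert h Q) J = J h * orderedProd Q J := by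
  rw [orderedProd, Finset.sort_insert _ (fun b hb => (hQ b hb).le)
    (fun hh => lt_irrefl _ (hQ h hh)), List.map_cons, List.prod_cons, orderedProd]

/-- The head of the list multiplies from the left, so an increasing list yields the units in the
order of `orderedProd`. -/
theorem partialSlice_eq_sum (F : (Fin n → ℂ) → Finset (Fin n) → ℍ[ℝ]) {l : List (Fin n)}
    (hl : l.Pairwise (· < ·)) (p : (Fin n → ℂ) × (Fin n → ℍ[ℝ])) (K : Finset (Fin n)) :
    partialSlice F l p K = ∑ Q ∈ l.toFinset.powerset,
      orderedProd Q (fun h => unitOf (p.2 h)) * F (mixedPoint l p) (K ∪ Q) := by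
  induction l generalizing p K with
  | nil => simp [partialSlice, mixedPoint, orderedProd]
  | cons a l ih =>
    rw [List.pairwise_cons] at hl
    have ha : a ∉ l.toFinset := fun h => lt_irrefl _ (hl.1 a (List.mem_toFinset.1 h))
    simp only [partialSlice]
    rw [ih hl.2, ih hl.2, List.toFinset_cons, Finset.sum_powerset_insert ha,
      Finset.mul_sum]
    congr 1
    refine Finset.sum_congr rfl fun Q hQ => ?_
    rw [orderedProd_insert fun k hk => hl.1 k (List.mem_toFinset.1 (Finset.mem_powerset.1 hQ hk)),
      mul_assoc, Finset.insert_union, Finset.union_insert]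
    rfl

theorem IsSliceC1.contDiffOn (ho : IsOpen D) {f : (Fin n → ℍ[ℝ]) → ℍ[ℝ]} (hf : IsSliceC1 D f) :
    ContDiffOn ℝ 1 f (circ D) := by
  obtain ⟨F, hF, hF1, hFf⟩ := hf
  have hmix : ∀ x : Fin n → ℍ[ℝ],
      mixedPoint (List.finRange n) (0, x) = fun h => upperPoint (x h) := by
    intro x
    funext k
    rw [mixedPoint_apply]
    simp
  -- With every variable in the list, the component at `∅` is `f` itself, and the complex argument,
  -- set to `0` below, is overwritten entirely.
  have h1 := hF.contDiffOn_partialSlice ho hF1 (List.nodup_finRange n) (K := ∅) (by simp)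
  have h2 : ContDiff ℝ 1 fun x : Fin n → ℍ[ℝ] => ((0 : Fin n → ℂ), x) :=
    contDiff_const.prodMk contDiff_id
  have hmem : ∀ x ∈ circ D, (fun h => upperPoint (x h)) ∈ D := fun x hx => hF.1.mem_circ_iff.1 hx
  refine (h1.comp h2.contDiffOn fun x hx => ?_).congr fun x hx => ?_
  · rw [mem_preimage, hmix]
    exact hmem x hx
  · have h3 := hFf _ (hmem x hx) (fun h => unitOf (x h)) (fun h => unitOf_mul_self _)
    rw [point_unitOf] at h3
    simp only [Function.comp_apply]
    rw [h3, partialSlice_eq_sum F (List.pairwise_lt_finRange n), hmix]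
    simp

end SeveralVariables

end SliceFueter

theorem corollary4p6 {n : ℕ} (m : Fin n) (D : Set (Fin n → ℂ)) (hD : IsOpen D)
    (hDc : IsConjInvariant D) (f : (Fin n → ℍ[ℝ]) → ℍ[ℝ]) (hf : IsSliceRegularIn D m f) :
    IsCIn 2 D m f ∧
    (IsSlice D (lapl m f) ∧ IsCIn 1 D m (lapl m f) ∧ ∀ x ∈ circ D, dbar m (lapl m f) x = 0) ∧
    (IsSliceC1 D f → IsAxiallyMonogenic D m (lapl m f)) := by
  have h1 := hf.isSlice_lapl hD hDc
  have h2 := hf.dbar_lapl_eq_zero hD hDc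
  exact ⟨hf.isCIn_two hD hDc, ⟨h1, hf.isCIn_one_lapl hD hDc, h2⟩,
    fun hC => ⟨h1, hf.contDiffOn_lapl hD hDc (hC.contDiffOn hD), h2⟩⟩
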